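/- All graphs are finite, simple and undirected. A $w$-expression is a term built from the following operations, and it describes a graph whose vertices carry labels from $\{1,\dots,w\}$: introducing a single vertex $v$ with a label $i$; the disjoint union of two labelled graphs; renaming label $i$ to label $j$; and connecting each vertex of label $i$ with each (other) vertex of label $j$. It is a $w$-expression of $G$ if the graph that it describes, with the labels forgotten, is $G$; its length $|\Psi|$ is the number of its operations. An instance $(G,T,k)$ of Node Multiway Cut consists of a graph $G$, a set $T\subseteq V(G)$ of terminals and an integer $k\ge 0$; it is a yes-instance if there is a set $S\subseteq V(G)\setminus T$ with $|S|\le k$ such that $G\setminus S$ has no path between two distinct terminals. Theorem. There are a single algorithm and a constant $c$ such that, given any $w \ge 1$, any instance $(G,T,k)$ of Node Multiway Cut with $n=|V(G)|$ and any $w$-expression $\Psi$ of $G$, the algorithm correctly decides whether $(G,T,k)$ is a yes-instance and halts within $$c\cdot|\Psi|\cdot (w+3)^{2w}\cdot n^{c}$$ steps. In particular, Node Multiway Cut can be solved in time $(w+3)^{2w}\cdot n^{O(1)}$ if a $w$-expression of $G$, of length polynomial in $n$, is given. Here an algorithm is a first-order functional program on binary trees of cons cells, and each elementary operation (variable access,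 constant, cons, head, tail, test for nil, local binding, function call) counts as one step; the input consists of $\Psi$ (which determines $G$), the list of the terminals and $k$, with labels, vertices and $k$ written as unary numerals. -/

import Mathlib

/-! ### Model of computation

First-order functional programs on binary trees of cons cells ("pure first-order Lisp").  Every
elementary operation costs one step and manipulates a bounded number of pointers, so a random
access machine executes a program in time proportional to the number of steps counted here. -/

/-- The data of a program: binary trees built from cons cells. -/
inductive Val : Type
  | nil : Val
  | cons : Val → Val → Val
  deriving DecidableEq

namespace Val

/-- First component of a cons cell (`nil` for `nil`). -/
def head : Val → Val
  | nil => nil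
  | cons a _ => a

/-- Second component of a cons cell (`nil` for `nil`). -/
def tail : Val → Val
  | nil => nil
  | cons _ b => b

/-- Truth values: `nil` is "no" and `cons nil nil` is "yes". -/
def ofBool : Bool → Val
  | false => nil
  | true => cons nil nil

/-- Unary numerals. -/
def ofNat : ℕ → Val
  | 0 => nil
  | m + 1 => cons nil (ofNat m)

/-- Lists, as right-nested cons cells. -/
def ofList : List Val → Val
  | [] => nil
  | a :: l => cons a (ofList l)

end Val

/-- Expressions of the programming language.  Variables are de Bruijn indices. -/
inductive Expr : Type
  /-- the value of the `i`-th variable -/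
  | var (i : ℕ) : Expr
  /-- the constant `nil` -/
  | nil : Expr
  /-- a new cons cell -/
  | cons (a b : Expr) : Expr
  /-- first component -/
  | head (a : Expr) : Expr
  /-- second component -/
  | tail (a : Expr) : Expr
  /-- evaluate `a` if the value of `c` is a cons cell, and `b` if it is `nil` -/
  | ite (c a b : Expr) : Expr
  /-- evaluate `a`, and then `b` with the result as the new variable `0` -/
  | bind (a b : Expr) : Expr
  /-- call the `f`-th function with one argument -/
  | call (f : ℕ) (a : Expr) : Expr

/-- A program: a main expression (its variable `0` is the input) and the bodies of finitely many
mutually recursive functions (the variable `0` of a body is the argument). -/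
structure Program : Type where
  main : Expr
  funs : List Expr

/-- `Eval P ρ e v t`: when the variables have the values `ρ`, evaluating `e` terminates after
exactly `t` steps with value `v` (call by value). -/
inductive Eval (P : Program) : List Val → Expr → Val → ℕ → Prop
  | var (ρ : List Val) (i : ℕ) : Eval P ρ (.var i) (ρ.getD i .nil) 1
  | nil (ρ : List Val) : Eval P ρ .nil .nil 1
  | cons {ρ : List Val} {a b : Expr} {u v : Val} {s t : ℕ} :
      Eval P ρ a u s → Eval P ρ b v t → Eval P ρ (.cons a b) (.cons u v) (s + t + 1)
  | head {ρ : List Val} {a : Expr} {u : Val} {s : ℕ} :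
      Eval P ρ a u s → Eval P ρ (.head a) u.head (s + 1)
  | tail {ρ : List Val} {a : Expr} {u : Val} {s : ℕ} :
      Eval P ρ a u s → Eval P ρ (.tail a) u.tail (s + 1)
  | ite_cons {ρ : List Val} {c a b : Expr} {x y v : Val} {s t : ℕ} :
      Eval P ρ c (.cons x y) s → Eval P ρ a v t → Eval P ρ (.ite c a b) v (s + t + 1)
  | ite_nil {ρ : List Val} {c a b : Expr} {v : Val} {s t : ℕ} :
      Eval P ρ c .nil s → Eval P ρ b v t → Eval P ρ (.ite c a b) v (s + t + 1)
  | bind {ρ : List Val} {a b : Expr} {u v : Val} {s t : ℕ} :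
      Eval P ρ a u s → Eval P (u :: ρ) b v t → Eval P ρ (.bind a b) v (s + t + 1)
  | call {ρ : List Val} {f : ℕ} {a body : Expr} {u v : Val} {s t : ℕ} :
      P.funs[f]? = some body → Eval P ρ a u s → Eval P [u] body v t →
      Eval P ρ (.call f a) v (s + t + 1)

/-- Value and running time of an evaluation are unique. -/
theorem Eval.unique {P : Program} {ρ : List Val} {e : Expr} {v : Val} {t : ℕ}
    (h : Eval P ρ e v t) : ∀ {v' : Val} {t' : ℕ}, Eval P ρ e v' t' → v = v' ∧ t = t' := by
  induction h with
  | var => intro v' t' h'; cases h'; exact ⟨rfl, rfl⟩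
  | nil => intro v' t' h'; cases h'; exact ⟨rfl, rfl⟩
  | cons _ _ ih1 ih2 =>
    intro v' t' h'
    cases h' with
    | cons h1 h2 =>
      obtain ⟨rfl, rfl⟩ := ih1 h1
      obtain ⟨rfl, rfl⟩ := ih2 h2
      exact ⟨rfl, rfl⟩
  | head _ ih =>
    intro v' t' h'
    cases h' with
    | head h1 =>
      obtain ⟨rfl, rfl⟩ := ih h1
      exact ⟨rfl, rfl⟩
  | tail _ ih =>
    intro v' t' h'
    cases h' with
    | tail h1 =>
      obtain ⟨rfl, rfl⟩ := ih h1
      exact ⟨rfl, rfl⟩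
  | ite_cons _ _ ih1 ih2 =>
    intro v' t' h'
    cases h' with
    | ite_cons h1 h2 =>
      obtain ⟨_, rfl⟩ := ih1 h1
      obtain ⟨rfl, rfl⟩ := ih2 h2
      exact ⟨rfl, rfl⟩
    | ite_nil h1 h2 => exact absurd (ih1 h1).1 (by simp)
  | ite_nil _ _ ih1 ih2 =>
    intro v' t' h'
    cases h' with
    | ite_cons h1 h2 => exact absurd (ih1 h1).1 (by simp)
    | ite_nil h1 h2 =>
      obtain ⟨_, rfl⟩ := ih1 h1
      obtain ⟨rfl, rfl⟩ := ih2 h2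
      exact ⟨rfl, rfl⟩
  | bind _ _ ih1 ih2 =>
    intro v' t' h'
    cases h' with
    | bind h1 h2 =>
      obtain ⟨rfl, rfl⟩ := ih1 h1
      obtain ⟨rfl, rfl⟩ := ih2 h2
      exact ⟨rfl, rfl⟩
  | call hf _ _ ih1 ih2 =>
    intro v' t' h'
    cases h' with
    | call hf' h1 h2 =>
      rw [hf] at hf'
      cases hf'
      obtain ⟨rfl, rfl⟩ := ih1 h1
      obtain ⟨rfl, rfl⟩ := ih2 h2
      exact ⟨rfl, rfl⟩

/-- On input `x` the program `P` halts after exactly `t` steps with output `y`. -/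
def Program.Runs (P : Program) (x y : Val) (t : ℕ) : Prop :=
  Eval P [x] P.main y t

/-! ### Clique-width expressions -/

/-- Terms over the operations of `w`-expressions, with labels in `Fin w` and vertex names in `V`. -/
inductive WExpr (V : Type) (w : ℕ) : Type
  /-- a single vertex `v` with label `i` -/
  | intro (i : Fin w) (v : V) : WExpr V w
  /-- disjoint union -/
  | union (a b : WExpr V w) : WExpr V w
  /-- every vertex with label `i` receives label `j` -/
  | rename (i j : Fin w) (a : WExpr V w) : WExpr V w
  /-- connect each vertex with label `i` with each vertex with label `j` -/
  | join (i j : Fin w) (a : WExpr V w) : WExpr V w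

namespace WExpr

/-- The vertices of the graph described by an expression. -/
def verts {V : Type} [DecidableEq V] {w : ℕ} : WExpr V w → Finset V
  | intro _ v => {v}
  | union a b => a.verts ∪ b.verts
  | rename _ _ a => a.verts
  | join _ _ a => a.verts

/-- `Φ.HasLabel v l`: `v` is a vertex with label `l` of the graph described by `Φ`. -/
def HasLabel {V : Type} {w : ℕ} : WExpr V w → V → Fin w → Prop
  | intro i u, v, l => v = u ∧ l = i
  | union a b, v, l => a.HasLabel v l ∨ b.HasLabel v l
  | rename i j a, v, l => (a.HasLabel v l ∧ l ≠ i) ∨ (a.HasLabel v i ∧ l = j)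
  | join _ _ a, v, l => a.HasLabel v l

/-- The adjacency relation described by an expression. -/
def graph {V : Type} {w : ℕ} : WExpr V w → SimpleGraph V
  | intro _ _ => ⊥
  | union a b => a.graph ⊔ b.graph
  | rename _ _ a => a.graph
  | join i j a => a.graph ⊔ SimpleGraph.fromRel (fun u v => a.HasLabel u i ∧ a.HasLabel v j)

/-- Every union that occurs in the expression is a disjoint union. -/
def Valid {V : Type} [DecidableEq V] {w : ℕ} : WExpr V w → Prop
  | intro _ _ => True
  | union a b => a.Valid ∧ b.Valid ∧ Disjoint a.verts b.verts
  | rename _ _ a => a.Valid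
  | join _ _ a => a.Valid

/-- `Φ` is a `w`-expression of the graph `G`, whose vertex set is the whole of `V`. -/
def IsExpressionOf {V : Type} [DecidableEq V] [Fintype V] {w : ℕ}
    (Φ : WExpr V w) (G : SimpleGraph V) : Prop :=
  Φ.Valid ∧ Φ.verts = Finset.univ ∧ Φ.graph = G

/-- The length of an expression: its number of operations. -/
def size {V : Type} {w : ℕ} : WExpr V w → ℕ
  | intro _ _ => 1
  | union a b => a.size + b.size + 1
  | rename _ _ a => a.size + 1
  | join _ _ a => a.size + 1

/-- An expression as a tree: a numeral for the operation, followed by its operands. -/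
def encode {n w : ℕ} : WExpr (Fin n) w → Val
  | intro i v => .cons (.ofNat 0) (.cons (.ofNat i) (.ofNat v))
  | union a b => .cons (.ofNat 1) (.cons a.encode b.encode)
  | rename i j a => .cons (.ofNat 2) (.cons (.ofNat i) (.cons (.ofNat j) a.encode))
  | join i j a => .cons (.ofNat 3) (.cons (.ofNat i) (.cons (.ofNat j) a.encode))

end WExpr

/-! ### Node Multiway Cut -/

/-- `(G, T, k)` is a yes-instance of Node Multiway Cut: at most `k` non-terminal vertices can be
deleted so that no path between two distinct terminals survives. -/
def NodeMultiwayCut {V : Type} (G : SimpleGraph V) (T : Finset V) (k : ℕ) : Prop :=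
  ∃ S : Finset V, S.card ≤ k ∧ Disjoint S T ∧
    ∀ s ∈ T, ∀ t ∈ T, s ≠ t → ∀ p : G.Walk s t, ∃ x ∈ p.support, x ∈ S

/-- The input of an algorithm for Node Multiway Cut with a given `w`-expression.  The graph is the
one described by the expression.  The terminals are listed in increasing order. -/
def encodeInstance {n w : ℕ} (Ψ : WExpr (Fin n) w) (T : Finset (Fin n)) (k : ℕ) : Val :=
  .cons Ψ.encode
    (.cons (.ofList ((T.sort (· ≤ ·)).map fun v => .ofNat v)) (.ofNat k))

-- A set `S` of non-terminals is a multiway cut iff the vertices can be coloured so that edges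
-- outside `S` are monochromatic and distinct terminals get distinct colours. The dynamic program
-- runs over the expression and decides, for each list of demands on such a colouring, the least
-- number of deletions that meets it (`Sol`, `Solvable`, `cost`). Demands flow from the root to the
-- leaves: a state says for each label that its survivors are free, absent, or all of one named
-- colour, and for each named colour whether it may contain a terminal. Colours are `.inl r` (named,
-- visible to the state), `.inr (some t)` (private to the terminal `t`) or `.inr none` (without
-- terminals).
--
-- Only a join needs a case distinction. Either label `i` has no survivors, or label `j` has none,
-- or the complete bipartite connection forces all survivors of both labels into one colour `r`. If
-- no demand mentions `r`, it is a new name for a so far anonymous colour and may contain a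
-- terminal. With `W` names for `W` labels a free name always exists when label `i` is free
-- (`exists_unused`). Conversely, a name that no demand mentions can be given back: its colour class
-- has at most one terminal and becomes private (`Sol.avoid`). At a union each permission to contain
-- a terminal goes to exactly one side, so that a colour does not collect two terminals. At the root
-- nothing is demanded or permitted, so every terminal has its private colour, which is separation
-- (`exists_solvable_iff`). The induction over the expression is `isLeastCost_cost`.
--
-- The program does not receive `w`; it takes `W` to be the largest label plus `3`. Hence `W ≤ w +
-- 2`, and the names `W, …, 2 * W - 1` never collide with the codes `0`, `1`, `2`. A table has `(2 *
-- W) ^ W * 2 ^ W` entries, some of them for ill-formed states and never relied upon, and an entry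
-- for a union costs up to about `4 ^ W` for the distributions of the permissions. Together with
-- polynomial factors this is at most `(32 * (w + 3)) ^ (w + 2)` times a cube; the part `1024 ^ w`
-- that arises from the constants is absorbed by the second factor `(w + 3) ^ w` (`exists_pow_le`,
-- `time_le`). Running times are derived from a weakest-precondition calculus (`WP`, `Spec`).

namespace MultiwayCut

/-! ### Costs: `0` means infeasible and `m + 1` means cost `m` -/

/-- Sum of two costs. -/
def addCost (a b : ℕ) : ℕ := if a = 0 then 0 else if b = 0 then 0 else a - 1 + b

/-- Minimum of two costs. -/
def minCost (a b : ℕ) : ℕ := if a = 0 then b else if b = 0 then a else if a ≤ b then a else b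

/-- `a` is the least `m` with `Q m`, as a cost. -/
def IsLeastCost (Q : ℕ → Prop) (a : ℕ) : Prop :=
  (∀ m, Q m → a ≠ 0 ∧ a ≤ m + 1) ∧ (a ≠ 0 → Q (a - 1))

theorem IsLeastCost.congr {Q R : ℕ → Prop} {a : ℕ} (h : IsLeastCost Q a) (e : ∀ m, R m ↔ Q m) :
    IsLeastCost R a :=
  ⟨fun m hm => h.1 m ((e m).1 hm), fun ha => (e _).2 (h.2 ha)⟩

theorem isLeastCost_false {Q : ℕ → Prop} (h : ∀ m, ¬ Q m) : IsLeastCost Q 0 :=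
  ⟨fun m hm => absurd hm (h m), fun h0 => absurd rfl h0⟩

/-- The closure properties `min` and `add` let the recursion for `cost` be checked against case
distinctions and sums in the meaning of a state. -/
theorem IsLeastCost.min {Q R : ℕ → Prop} {a b : ℕ} (ha : IsLeastCost Q a) (hb : IsLeastCost R b) :
    IsLeastCost (fun m => Q m ∨ R m) (minCost a b) := by
  unfold minCost
  constructor
  · rintro m (hm | hm)
    · have := ha.1 m hm
      split_ifs <;> omega
    · have := hb.1 m hm
      split_ifs <;> omega
  · intro h
    split_ifs at h ⊢
    · exact Or.inr (hb.2 h)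
    · exact Or.inl (ha.2 h)
    · exact Or.inl (ha.2 h)
    · exact Or.inr (hb.2 h)

theorem IsLeastCost.add {Q R : ℕ → Prop} {a b : ℕ} (ha : IsLeastCost Q a) (hb : IsLeastCost R b) :
    IsLeastCost (fun m => ∃ k l, m = k + l ∧ Q k ∧ R l) (addCost a b) := by
  unfold addCost
  constructor
  · rintro m ⟨k, l, rfl, hk, hl⟩
    have := ha.1 k hk
    have := hb.1 l hl
    split_ifs <;> omega
  · intro h
    split_ifs at h ⊢ with h1 h2
    · exact absurd rfl h
    · exact absurd rfl h
    · exact ⟨a - 1, b - 1, by omega, ha.2 h1, hb.2 h2⟩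

/-! ### The dynamic program

A state for `W` labels is a list of `2 * W` digits.  Digit `i < W` tells what is demanded from the
surviving vertices with label `i`: nothing (`0`), that there are none (`2`), or that all have the
colour `r` (`W ≤ r < 2 * W`).  Digit `r` with `W ≤ r < 2 * W` is `1` if colour `r` may
contain a terminal, and `0` otherwise. -/

/-- Cost of a union: the colours that may contain a terminal are distributed. -/
def splitCost : List ℕ → (List ℕ → ℕ) → (List ℕ → ℕ) → ℕ
  | [], f, g => addCost (f []) (g [])
  | d :: st, f, g =>
    if d = 1 then
      minCost (splitCost st (fun l => f (1 :: l)) (fun l => g (0 :: l)))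
        (splitCost st (fun l => f (0 :: l)) (fun l => g (1 :: l)))
    else splitCost st (fun l => f (d :: l)) (fun l => g (d :: l))

/-- Demand colour `r` for the labels `i` and `j`; a new colour may contain a terminal. -/
def recolour (st : List ℕ) (i j r : ℕ) : List ℕ :=
  ((if r ∈ st then st else st.set r 1).set i r).set j r

/-- The demand `d` allows colour `r`. -/
def Compat (d r : ℕ) : Prop := d = 0 ∨ d = r

instance (d r : ℕ) : Decidable (Compat d r) := by unfold Compat; infer_instance

/-- Least cost over the colours `r, …, r + m - 1` for the labels `i` and `j`. -/
def joinCost (f : List ℕ → ℕ) (st : List ℕ) (i j : ℕ) : ℕ → ℕ → ℕ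
  | 0, _ => 0
  | m + 1, r =>
    minCost
      (if Compat (st.getD i 0) r then
        if Compat (st.getD j 0) r then f (recolour st i j r) else 0 else 0)
      (joinCost f st i j m (r + 1))

/-- Cost of a single vertex with label `i`, which is a terminal or not. -/
def introCost (term : Prop) [Decidable term] (st : List ℕ) (i : ℕ) : ℕ :=
  if term then
    if st.getD i 0 = 0 then 1 else if st.getD i 0 ≤ 2 then 0
    else if st.getD (st.getD i 0) 0 = 0 then 0 else 1
  else if st.getD i 0 = 0 then 1 else if st.getD i 0 ≤ 2 then 2 else 1

/-- The table of an expression. -/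
def cost {n w : ℕ} (W : ℕ) (T : Finset (Fin n)) : WExpr (Fin n) w → List ℕ → ℕ
  | .intro i v, st => introCost (v ∈ T) st i
  | .union a b, st => splitCost st (cost W T a) (cost W T b)
  | .rename i j a, st => cost W T a (st.set i (st.getD j 0))
  | .join i j a, st =>
    minCost (cost W T a (st.set i 2))
      (minCost (cost W T a (st.set j 2)) (joinCost (cost W T a) st i j W W))

/-- The largest label of an expression. -/
def maxLabel {n w : ℕ} : WExpr (Fin n) w → ℕ
  | .intro i _ => i
  | .union a b => max (maxLabel a) (maxLabel b)
  | .rename i j a => max i (max j (maxLabel a))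
  | .join i j a => max i (max j (maxLabel a))

/-! ### Meaning of the states -/

section semantics

variable {V : Type} [DecidableEq V] {w : ℕ}

theorem mem_verts_of_hasLabel {Φ : WExpr V w} {v : V} {l : Fin w} (h : Φ.HasLabel v l) :
    v ∈ Φ.verts := by
  induction Φ generalizing l with
  | intro i u => simpa [WExpr.verts] using h.1
  | union a b iha ihb =>
    rcases h with h | h
    · exact Finset.mem_union_left _ (iha h)
    · exact Finset.mem_union_right _ (ihb h)
  | rename i j a ih => rcases h with h | h <;> exact ih h.1
  | join i j a ih => exact ih h

theorem mem_verts_of_adj {Φ : WExpr V w} {u v : V} (h : Φ.graph.Adj u v) :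
    u ∈ Φ.verts ∧ v ∈ Φ.verts := by
  induction Φ with
  | intro i u => exact absurd h (by simp [WExpr.graph])
  | union a b iha ihb =>
    rcases h with h | h
    · exact ⟨Finset.mem_union_left _ (iha h).1, Finset.mem_union_left _ (iha h).2⟩
    · exact ⟨Finset.mem_union_right _ (ihb h).1, Finset.mem_union_right _ (ihb h).2⟩
  | rename i j a ih => exact ih h
  | join i j a ih =>
    rcases h with h | ⟨_, h | h⟩
    · exact ih h
    · exact ⟨mem_verts_of_hasLabel h.1, mem_verts_of_hasLabel h.2⟩
    · exact ⟨mem_verts_of_hasLabel h.2, mem_verts_of_hasLabel h.1⟩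

/-- After deletion of `S` the colouring `col` meets the demands `s`. -/
structure Sol (Φ : WExpr V w) (T : Finset V) (s : ℕ → ℕ) (S : Finset V)
    (col : V → ℕ ⊕ Option V) : Prop where
  sub : S ⊆ Φ.verts
  disj : Disjoint S T
  lab : ∀ v l, Φ.HasLabel v l → v ∉ S → s l ≠ 2 ∧ (s l ≠ 0 → col v = .inl (s l))
  edge : ∀ u v, Φ.graph.Adj u v → u ∉ S → v ∉ S → col u = col v
  term : ∀ t ∈ T, t ∈ Φ.verts → col t = .inr (some t) ∨ ∃ r, col t = .inl r ∧ s r = 1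
  inj : ∀ t ∈ T, t ∈ Φ.verts → ∀ t' ∈ T, t' ∈ Φ.verts → ∀ r, col t = .inl r →
    col t' = .inl r → t = t'

/-- The demands `s` can be met by the deletion of `m` vertices. -/
def Solvable (Φ : WExpr V w) (T : Finset V) (s : ℕ → ℕ) (m : ℕ) : Prop :=
  ∃ S col, Sol Φ T s S col ∧ S.card = m

/-- Well-formed states. -/
structure Proper (W : ℕ) (s : ℕ → ℕ) : Prop where
  label : ∀ l < W, s l = 0 ∨ s l = 2 ∨ (W ≤ s l ∧ s l < 2 * W)
  mark : ∀ r, W ≤ r → s r = 0 ∨ s r = 1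

-- Renamings and single vertices

/-- Vertices with label `i` below the renaming carry label `j` above it, so they inherit the demand
on `j`; the old demand on `i` constrains nobody. The side conditions keep the set of digits `1` (the
permissions) unchanged. -/
theorem solvable_rename {Φ : WExpr V w} {T : Finset V} {s : ℕ → ℕ} {i j : Fin w} {m : ℕ}
    (hi : s i ≠ 1) (hj : s j ≠ 1) :
    Solvable (.rename i j Φ) T s m ↔ Solvable Φ T (Function.update s i (s j)) m := by
  have h1 : ∀ r, Function.update s i (s j) r = 1 ↔ s r = 1 := by
    intro r
    by_cases hr : r = i
    · subst hr; simp [hi, hj]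
    · simp [hr]
  constructor
  · rintro ⟨S, col, h, rfl⟩
    refine ⟨S, col, ⟨h.sub, h.disj, ?_, h.edge, ?_, h.inj⟩, rfl⟩
    · intro v l hl hv
      by_cases hli : l = i
      · subst hli
        simpa using h.lab v j (Or.inr ⟨hl, rfl⟩) hv
      · have : (l : ℕ) ≠ i := fun e => hli (Fin.ext e)
        simpa [this] using h.lab v l (Or.inl ⟨hl, hli⟩) hv
    · simp only [h1]; exact h.term
  · rintro ⟨S, col, h, rfl⟩
    refine ⟨S, col, ⟨h.sub, h.disj, ?_, h.edge, ?_, h.inj⟩, rfl⟩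
    · rintro v l (⟨hl, hli⟩ | ⟨hl, rfl⟩) hv
      · have : (l : ℕ) ≠ i := fun e => hli (Fin.ext e)
        simpa [this] using h.lab v l hl hv
      · simpa using h.lab v i hl hv
    · have := h.term
      simp only [h1] at this
      exact this

/-- The vertex either survives, and then a terminal needs a free label or a permitted colour, or it
is deleted, which only a non-terminal can be. -/
theorem solvable_intro {T : Finset V} {s : ℕ → ℕ} {i : Fin w} {v : V} {m : ℕ} :
    Solvable (.intro i v) T s m ↔
      (m = 0 ∧ s i ≠ 2 ∧ (v ∈ T → s i = 0 ∨ s (s i) = 1)) ∨ (m = 1 ∧ v ∉ T) := by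
  constructor
  · rintro ⟨S, col, h, rfl⟩
    rcases Finset.subset_singleton_iff.1 h.sub with rfl | rfl
    · left
      have hl := h.lab v i ⟨rfl, rfl⟩ (by simp)
      refine ⟨rfl, hl.1, fun hv => ?_⟩
      by_contra! h0
      rcases h.term v hv (by simp [WExpr.verts]) with ht | ⟨r, hr, hr'⟩
      · have := hl.2 h0.1
        simp [ht] at this
      · have := hl.2 h0.1
        rw [hr] at this
        cases this
        exact h0.2 hr'
    · right
      exact ⟨rfl, by simpa using h.disj⟩
  · rintro (⟨rfl, h2, h3⟩ | ⟨rfl, hv⟩)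
    · refine ⟨∅, fun _ => if s i = 0 then .inr (some v) else .inl (s i),
        ⟨by simp, by simp, ?_, ?_, ?_, ?_⟩, rfl⟩
      · rintro u l ⟨rfl, rfl⟩ _
        exact ⟨h2, fun h0 => by simp [h0]⟩
      · simp
      · intro t ht htv
        have : t = v := by simpa [WExpr.verts] using htv
        subst this
        by_cases h0 : s i = 0
        · simp [h0]
        · have := h3 ht
          simp [h0] at this ⊢
          exact this
      · intro t ht htv t' ht' htv' _ _ _
        simp [WExpr.verts] at htv htv'
        rw [htv, htv']
    · refine ⟨{v}, fun _ => .inl 0, ⟨by simp [WExpr.verts], by simpa using hv, ?_, ?_, ?_, ?_⟩, rfl⟩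
      · rintro u l ⟨rfl, rfl⟩ hu
        simp at hu
      · simp [WExpr.graph]
      · intro t ht htv
        simp [WExpr.verts] at htv
        exact absurd ht (htv ▸ hv)
      · intro t ht htv
        simp [WExpr.verts] at htv
        exact absurd ht (htv ▸ hv)

-- Disjoint unions

/-- The digits `1` of `s` are distributed to `s₁` and `s₂`. -/
def Splits (s s₁ s₂ : ℕ → ℕ) : Prop :=
  ∀ r, (s r = 1 ∧ s₁ r = 1 ∧ s₂ r = 0) ∨ (s r = 1 ∧ s₁ r = 0 ∧ s₂ r = 1) ∨
    (s r ≠ 1 ∧ s₁ r = s r ∧ s₂ r = s r)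

/-- The two colourings are glued along the disjoint vertex sets. Named colours mean the same on both
sides, so the only danger is a named colour with a terminal on each side. -/
theorem solvable_union_of {a b : WExpr V w} {T : Finset V} {s s₁ s₂ : ℕ → ℕ} {k l : ℕ}
    (hd : Disjoint a.verts b.verts) (hs : Splits s s₁ s₂) (hl : ∀ v l, (WExpr.union a b).HasLabel v l → s l ≠ 1)
    (h₁ : Solvable a T s₁ k) (h₂ : Solvable b T s₂ l) : Solvable (.union a b) T s (k + l) := by
  obtain ⟨S₁, c₁, h₁, rfl⟩ := h₁
  obtain ⟨S₂, c₂, h₂, rfl⟩ := h₂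
  have hab : ∀ v, v ∈ a.verts → v ∉ b.verts := fun v h h' => Finset.disjoint_left.1 hd h h'
  have hnot : ∀ v, v ∈ b.verts → v ∉ a.verts := fun v h h' => hab v h' h
  have e1 : ∀ r, s₁ r = 1 → s r = 1 := fun r h => by
    rcases hs r with h' | h' | h' <;> omega
  have e2 : ∀ r, s₂ r = 1 → s r = 1 := fun r h => by
    rcases hs r with h' | h' | h' <;> omega
  have e3 : ∀ v l, (WExpr.union a b).HasLabel v l → s₁ l = s l ∧ s₂ l = s l := fun v l h => by
    have := hl v l h
    rcases hs l with h' | h' | h' <;> omega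
  refine ⟨S₁ ∪ S₂, fun v => if v ∈ a.verts then c₁ v else c₂ v, ⟨?_, ?_, ?_, ?_, ?_, ?_⟩, ?_⟩
  · exact Finset.union_subset_union h₁.sub h₂.sub
  · exact Finset.disjoint_union_left.2 ⟨h₁.disj, h₂.disj⟩
  · rintro v l (h | h) hv
    · have hv' := mem_verts_of_hasLabel h
      have := h₁.lab v l h (fun h => hv (Finset.mem_union_left _ h))
      simpa [hv', (e3 v l (Or.inl h)).1] using this
    · have hv' := hnot v (mem_verts_of_hasLabel h)
      have := h₂.lab v l h (fun h => hv (Finset.mem_union_right _ h))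
      simpa [hv', (e3 v l (Or.inr h)).2] using this
  · rintro u v (h | h) hu hv
    · have hh := mem_verts_of_adj h
      have := h₁.edge u v h (fun h => hu (Finset.mem_union_left _ h))
        (fun h => hv (Finset.mem_union_left _ h))
      simpa [hh] using this
    · have hh := mem_verts_of_adj h
      have := h₂.edge u v h (fun h => hu (Finset.mem_union_right _ h))
        (fun h => hv (Finset.mem_union_right _ h))
      simpa [hnot u hh.1, hnot v hh.2] using this
  · intro t ht htv
    rcases Finset.mem_union.1 htv with h | h
    · rcases h₁.term t ht h with h' | ⟨r, h', h''⟩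
      · left; simpa [h] using h'
      · right; exact ⟨r, by simpa [h] using h', e1 r h''⟩
    · rcases h₂.term t ht h with h' | ⟨r, h', h''⟩
      · left; simpa [hnot t h] using h'
      · right; exact ⟨r, by simpa [hnot t h] using h', e2 r h''⟩
  -- Two terminals of the same named colour on different sides would need the permission for that
  -- colour on both sides.
  · have key : ∀ t ∈ T, t ∈ a.verts → ∀ t' ∈ T, t' ∈ b.verts → ∀ r, c₁ t = .inl r →
        c₂ t' = .inl r → False := by
      intro t ht h t' ht' h' r hr hr'
      rcases h₁.term t ht h with q | ⟨r1, q, q1⟩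
      · simp [hr] at q
      rcases h₂.term t' ht' h' with p | ⟨r2, p, p1⟩
      · simp [hr'] at p
      rw [hr] at q; cases q
      rw [hr'] at p; cases p
      rcases hs r with h' | h' | h' <;> omega
    intro t ht htv t' ht' htv' r hr hr'
    rcases Finset.mem_union.1 htv with h | h <;> rcases Finset.mem_union.1 htv' with h' | h'
    · simp only [h, h', if_true] at hr hr'
      exact h₁.inj t ht h t' ht' h' r hr hr'
    · simp only [h, hnot t' h', if_true, if_false] at hr hr'
      exact (key t ht h t' ht' h' r hr hr').elim
    · simp only [h', hnot t h, if_true, if_false] at hr hr'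
      exact (key t' ht' h' t ht h r hr' hr).elim
    · simp only [hnot t h, hnot t' h', if_false] at hr hr'
      exact h₂.inj t ht h t' ht' h' r hr hr'
  · exact Finset.card_union_of_disjoint (Finset.disjoint_of_subset_left h₁.sub
      (Finset.disjoint_of_subset_right h₂.sub hd))

/-- The solution itself says how to distribute the permissions: `A` holds the colours whose terminal
lies in `a`. Any split that agrees with `A` then works, which leaves the choice of an actual list to
`exists_listSplits`. -/
theorem exists_of_solvable_union {a b : WExpr V w} {T : Finset V} {s : ℕ → ℕ} {m : ℕ}
    (hd : Disjoint a.verts b.verts) (hl : ∀ v l, (WExpr.union a b).HasLabel v l → s l ≠ 1)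
    (h : Solvable (.union a b) T s m) :
    ∃ A : ℕ → Prop, ∀ s₁ s₂, Splits s s₁ s₂ → (∀ r, s r = 1 → (A r ↔ s₁ r = 1)) →
      ∃ k l, m = k + l ∧ Solvable a T s₁ k ∧ Solvable b T s₂ l := by
  obtain ⟨S, c, h, rfl⟩ := h
  have hab : ∀ v, v ∈ a.verts → v ∉ b.verts := fun v h h' => Finset.disjoint_left.1 hd h h'
  have e3 : ∀ s₁ s₂, Splits s s₁ s₂ → ∀ v l, (WExpr.union a b).HasLabel v l →
      s₁ l = s l ∧ s₂ l = s l := fun s₁ s₂ hs v l h => by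
    have := hl v l h
    rcases hs l with h' | h' | h' <;> omega
  refine ⟨fun r => ∃ t ∈ T, t ∈ a.verts ∧ c t = .inl r, fun s₁ s₂ hs hA =>
    ⟨(S ∩ a.verts).card, (S ∩ b.verts).card, ?_, ⟨S ∩ a.verts, c, ⟨?_, ?_, ?_, ?_, ?_, ?_⟩, rfl⟩,
      ⟨S ∩ b.verts, c, ⟨?_, ?_, ?_, ?_, ?_, ?_⟩, rfl⟩⟩⟩
  · rw [← Finset.card_union_of_disjoint, ← Finset.inter_union_distrib_left]
    · exact congrArg _ (Finset.inter_eq_left.2 h.sub).symm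
    · exact Finset.disjoint_of_subset_left Finset.inter_subset_right
        (Finset.disjoint_of_subset_right Finset.inter_subset_right hd)
  · exact Finset.inter_subset_right
  · exact Finset.disjoint_of_subset_left Finset.inter_subset_left h.disj
  · intro v l hvl hv
    rw [(e3 s₁ s₂ hs v l (Or.inl hvl)).1]
    exact h.lab v l (Or.inl hvl) (fun h' => hv (Finset.mem_inter.2 ⟨h', mem_verts_of_hasLabel hvl⟩))
  · intro u v huv hu hv
    have hh := mem_verts_of_adj huv
    exact h.edge u v (Or.inl huv) (fun h' => hu (Finset.mem_inter.2 ⟨h', hh.1⟩))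
      (fun h' => hv (Finset.mem_inter.2 ⟨h', hh.2⟩))
  · intro t ht hta
    rcases h.term t ht (Finset.mem_union_left _ hta) with h' | ⟨r, h', h''⟩
    · exact Or.inl h'
    · exact Or.inr ⟨r, h', (hA r h'').1 ⟨t, ht, hta, h'⟩⟩
  · exact fun t ht hta t' ht' hta' => h.inj t ht (Finset.mem_union_left _ hta) t' ht'
      (Finset.mem_union_left _ hta')
  · exact Finset.inter_subset_right
  · exact Finset.disjoint_of_subset_left Finset.inter_subset_left h.disj
  · intro v l hvl hv
    rw [(e3 s₁ s₂ hs v l (Or.inr hvl)).2]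
    exact h.lab v l (Or.inr hvl) (fun h' => hv (Finset.mem_inter.2 ⟨h', mem_verts_of_hasLabel hvl⟩))
  · intro u v huv hu hv
    have hh := mem_verts_of_adj huv
    exact h.edge u v (Or.inr huv) (fun h' => hu (Finset.mem_inter.2 ⟨h', hh.1⟩))
      (fun h' => hv (Finset.mem_inter.2 ⟨h', hh.2⟩))
  · intro t ht htb
    rcases h.term t ht (Finset.mem_union_right _ htb) with h' | ⟨r, h', h''⟩
    · exact Or.inl h'
    · refine Or.inr ⟨r, h', ?_⟩
      -- If the permission had gone to `a`, a terminal of `a` would share colour `r` with `t`,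
      -- against injectivity on named colours.
      have : s₁ r ≠ 1 := by
        intro h1
        obtain ⟨t', ht', hta, ht''⟩ := (hA r h'').2 h1
        have := h.inj t ht (Finset.mem_union_right _ htb) t' ht' (Finset.mem_union_left _ hta) r
          h' ht''
        subst this
        exact hab t hta htb
      rcases hs r with q | q | q <;> omega
  · exact fun t ht hta t' ht' hta' => h.inj t ht (Finset.mem_union_right _ hta) t' ht'
      (Finset.mem_union_right _ hta')

-- Renaming colours and passing a join

/-- Colours outside `used` can be avoided if no demand mentions them. -/
theorem Sol.avoid {Φ : WExpr V w} {T : Finset V} {s : ℕ → ℕ} {S : Finset V}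
    {col : V → ℕ ⊕ Option V} (h : Sol Φ T s S col) (used : ℕ → Prop)
    (hu : ∀ v l, Φ.HasLabel v l → s l = 0 ∨ s l = 2 ∨ used (s l)) :
    ∃ col', Sol Φ T s S col' ∧ ∀ v r, col' v = .inl r → used r := by
  classical
  -- Recolouring through a function of the old colour keeps edges monochromatic. An unused named
  -- class moves to the private colour of its terminal, unique by `h.inj`, or to `.inr none` if it
  -- has no terminal.
  let g : ℕ ⊕ Option V → ℕ ⊕ Option V := fun c => match c with
    | .inr o => .inr o
    | .inl r => if used r then .inl r else
        if h : ∃ t ∈ T, t ∈ Φ.verts ∧ col t = .inl r then .inr (some h.choose) else .inr none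
  have g1 : ∀ r, used r → g (.inl r) = .inl r := fun r hr => by simp [g, hr]
  have g2 : ∀ c r, g c = .inl r → c = .inl r ∧ used r := by
    rintro (r | o) r' h'
    · simp only [g] at h'
      split_ifs at h' with h1
      · cases h'; exact ⟨rfl, h1⟩
    · simp [g] at h'
  refine ⟨fun v => g (col v), ⟨h.sub, h.disj, ?_, ?_, ?_, ?_⟩, fun v r hr => (g2 _ _ hr).2⟩
  · intro v l hvl hv
    have := h.lab v l hvl hv
    refine ⟨this.1, fun h0 => ?_⟩
    have hu' : used (s l) := by
      rcases hu v l hvl with h' | h' | h'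
      · exact absurd h' h0
      · exact absurd h' this.1
      · exact h'
    simp only [this.2 h0, g1 _ hu']
  · intro u v huv hu hv
    simp only [h.edge u v huv hu hv]
  · intro t ht htv
    rcases h.term t ht htv with h' | ⟨r, h', h''⟩
    · left; simp [h', g]
    · by_cases hr : used r
      · right; exact ⟨r, by simp only [h', g1 r hr], h''⟩
      · left
        have hex : ∃ t ∈ T, t ∈ Φ.verts ∧ col t = .inl r := ⟨t, ht, htv, h'⟩
        have hc := hex.choose_spec
        have : hex.choose = t := h.inj _ hc.1 hc.2.1 t ht htv r hc.2.2 h'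
        simp only [h', g, if_neg hr, dif_pos hex, this]
  · intro t ht htv t' ht' htv' r hr hr'
    exact h.inj t ht htv t' ht' htv' r (g2 _ _ hr).1 (g2 _ _ hr').1

/-- If `s'` refines `s` on labels and permits no more colours, then only the new edges matter, and
`hij` makes them vacuous or monochromatic. -/
theorem Sol.join_of {Φ : WExpr V w} {T : Finset V} {s s' : ℕ → ℕ} {S : Finset V} {i j : Fin w}
    {col : V → ℕ ⊕ Option V} (h : Sol Φ T s' S col)
    (hlab : ∀ l : Fin w, s' l ≠ 2 → s l ≠ 2 ∧ (s l ≠ 0 → s' l = s l))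
    (hone : ∀ r, s' r = 1 → s r = 1)
    (hij : s' i = 2 ∨ s' j = 2 ∨ (s' i ≠ 0 ∧ s' i = s' j)) : Sol (.join i j Φ) T s S col := by
  have key : ∀ u v, Φ.HasLabel u i → Φ.HasLabel v j → u ∉ S → v ∉ S → col u = col v := by
    intro u v hu hv hu' hv'
    have h1 := h.lab u i hu hu'
    have h2 := h.lab v j hv hv'
    rcases hij with q | q | ⟨q, q'⟩
    · exact absurd q h1.1
    · exact absurd q h2.1
    · rw [h1.2 q, h2.2 (q' ▸ q), q']
  refine ⟨h.sub, h.disj, ?_, ?_, ?_, h.inj⟩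
  · intro v l hvl hv
    have h1 := h.lab v l hvl hv
    have h2 := hlab l h1.1
    refine ⟨h2.1, fun h0 => ?_⟩
    have h3 := h2.2 h0
    rw [← h3]
    exact h1.2 (h3 ▸ h0)
  · rintro u v (huv | ⟨_, huv | huv⟩) hu hv
    · exact h.edge u v huv hu hv
    · exact key u v huv.1 huv.2 hu hv
    · exact (key v u huv.1 huv.2 hv hu).symm
  · intro t ht htv
    rcases h.term t ht htv with h' | ⟨r, h', h''⟩
    · exact Or.inl h'
    · exact Or.inr ⟨r, h', hone r h''⟩

/-- The operand has fewer edges, so the same colouring serves; only the changed demands have to be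
verified. -/
theorem Sol.of_join {Φ : WExpr V w} {T : Finset V} {s s' : ℕ → ℕ} {S : Finset V} {i j : Fin w}
    {col : V → ℕ ⊕ Option V} (h : Sol (.join i j Φ) T s S col)
    (hlab : ∀ v (l : Fin w), Φ.HasLabel v l → v ∉ S → s l ≠ 2 → (s l ≠ 0 → col v = .inl (s l)) →
      s' l ≠ 2 ∧ (s' l ≠ 0 → col v = .inl (s' l)))
    (hone : ∀ r, s r = 1 → s' r = 1) : Sol Φ T s' S col := by
  refine ⟨h.sub, h.disj, ?_, ?_, ?_, h.inj⟩
  · intro v l hvl hv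
    have h1 := h.lab v l hvl hv
    exact hlab v l hvl hv h1.1 h1.2
  · exact fun u v huv => h.edge u v (Or.inl huv)
  · intro t ht htv
    rcases h.term t ht htv with h' | ⟨r, h', h''⟩
    · exact Or.inl h'
    · exact Or.inr ⟨r, h', hone r h''⟩

end semantics

-- The three cases of a join

section semantics

variable {V : Type} [DecidableEq V] {w : ℕ}

theorem Proper.ne_one {W : ℕ} {s : ℕ → ℕ} (h : Proper W s) (hW : 3 ≤ W) {l : ℕ} (hl : l < W) :
    s l ≠ 1 := by
  rcases h.label l hl with h' | h' | h' <;> omega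

/-- Demand colour `r` for the labels `i` and `j`; a new colour may contain a terminal. -/
noncomputable def recolourFun (W : ℕ) (s : ℕ → ℕ) (i j r : ℕ) : ℕ → ℕ :=
  open Classical in
  Function.update (Function.update (if ∃ l < W, s l = r then s else Function.update s r 1) i r) j r

/-- Pigeonhole: label `i` names no colour, so the other `W - 1` labels cannot name all `W` colours.
-/
theorem exists_unused {W : ℕ} {s : ℕ → ℕ} {i : ℕ} (hi : i < W)
    (h0 : s i = 0) : ∃ r, W ≤ r ∧ r < 2 * W ∧ ∀ l < W, s l ≠ r := by
  by_contra! hc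
  have : Finset.Ico W (2 * W) ⊆ ((Finset.range W).erase i).image s := by
    intro r hr
    obtain ⟨h1, h2⟩ := Finset.mem_Ico.1 hr
    obtain ⟨l, hl, hlr⟩ := hc r h1 h2
    refine Finset.mem_image.2 ⟨l, Finset.mem_erase.2 ⟨?_, Finset.mem_range.2 hl⟩, hlr⟩
    rintro rfl
    omega
  have h1 := (Finset.card_le_card this).trans Finset.card_image_le
  rw [Finset.card_erase_of_mem (Finset.mem_range.2 hi)] at h1
  simp at h1
  omega

theorem solvable_join_of_dead {Φ : WExpr V w} {T : Finset V} {s : ℕ → ℕ} {i j a : Fin w} {m : ℕ}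
    (ha : a = i ∨ a = j) (h : Solvable Φ T (Function.update s a 2) m) :
    Solvable (.join i j Φ) T s m := by
  obtain ⟨S, col, h, rfl⟩ := h
  refine ⟨S, col, h.join_of ?_ ?_ ?_, rfl⟩
  · intro l hl
    by_cases hla : (l : ℕ) = a
    · simp [hla] at hl
    · simp [hla] at hl ⊢; exact hl
  · intro r hr
    by_cases hra : r = a
    · simp [hra] at hr
    · simpa [hra] using hr
  · rcases ha with rfl | rfl <;> simp

/-- If `r` is already named by a demand, the new demands refine the old ones without a new
permission. Otherwise `r` was introduced here, and `Sol.avoid` removes it from the colouring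
together with its permission. -/
theorem solvable_join_of_recolour {Φ : WExpr V w} {T : Finset V} {s : ℕ → ℕ} {i j : Fin w}
    {m W r : ℕ} (hW : 3 ≤ W) (hΦ : ∀ v l, Φ.HasLabel v l → (l : ℕ) < W)
    (hr : W ≤ r) (hri : Compat (s i) r) (hrj : Compat (s j) r)
    (h : Solvable Φ T (recolourFun W s i j r) m) (hi : (i : ℕ) < W) (hj : (j : ℕ) < W) :
    Solvable (.join i j Φ) T s m := by
  classical
  obtain ⟨S, col, h, rfl⟩ := h
  unfold Compat at hri hrj
  by_cases hu : ∃ l < W, s l = r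
  · simp only [recolourFun, if_pos hu] at h
    refine ⟨S, col, h.join_of ?_ ?_ ?_, rfl⟩
    · intro l hl
      simp only [Function.update_apply] at hl ⊢
      split_ifs at hl ⊢ with h1 h2
      · rw [h1]; omega
      · rw [h2]; omega
      · exact ⟨hl, fun _ => rfl⟩
    · intro q hq
      simp only [Function.update_apply] at hq
      split_ifs at hq
      · omega
      · omega
      · exact hq
    · right; right
      simp only [Function.update_apply]
      split_ifs <;> simp <;> omega
  · simp only [recolourFun, if_neg hu] at h
    have hsi : s i = 0 := hri.resolve_right fun h' => hu ⟨i, hi, h'⟩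
    have hsj : s j = 0 := hrj.resolve_right fun h' => hu ⟨j, hj, h'⟩
    -- Intermediate state: the demands of `s`, but with colour `r` still permitted. Once no vertex
    -- has colour `r`, the permission is irrelevant.
    have h' : Sol (.join i j Φ) T (Function.update s r 1) S col := by
      refine h.join_of ?_ ?_ ?_
      · intro l hl
        simp only [Function.update_apply] at hl ⊢
        split_ifs at hl ⊢ with h1 h2 h3 h3 h3
        all_goals first | omega | simp_all
      · intro q hq
        simp only [Function.update_apply] at hq ⊢
        split_ifs at hq ⊢ <;> omega
      · right; right
        simp only [Function.update_apply]
        split_ifs <;> simp <;> omega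
    obtain ⟨col', h2, h3⟩ := h'.avoid (fun x => x ≠ r) (fun v l hvl => by
      have hl : (l : ℕ) < W := hΦ v l hvl
      have : (l : ℕ) ≠ r := by omega
      rw [Function.update_of_ne this]
      exact Or.inr (Or.inr fun h' => hu ⟨l, hl, h'⟩))
    refine ⟨S, col', ⟨h2.sub, h2.disj, ?_, h2.edge, ?_, h2.inj⟩, rfl⟩
    · intro v l hvl hv
      have hl : (l : ℕ) < W := hΦ v l hvl
      have : (l : ℕ) ≠ r := by omega
      simpa only [Function.update_of_ne this] using h2.lab v l hvl hv
    · intro t ht htv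
      rcases h2.term t ht htv with q | ⟨q, q1, q2⟩
      · exact Or.inl q
      · exact Or.inr ⟨q, q1, by rwa [Function.update_of_ne (h3 _ _ q1)] at q2⟩

/-- If both labels have survivors, all these share one colour. A named colour is kept; a private or
anonymous one receives an unused name. -/
theorem cases_of_solvable_join {Φ : WExpr V w} {T : Finset V} {s : ℕ → ℕ} {i j : Fin w}
    {m W : ℕ} (hs : Proper W s) (hW : 3 ≤ W) (hΦ : ∀ v l, Φ.HasLabel v l → (l : ℕ) < W)
    (hi : (i : ℕ) < W) (hj : (j : ℕ) < W) (h : Solvable (.join i j Φ) T s m) :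
    Solvable Φ T (Function.update s i 2) m ∨ Solvable Φ T (Function.update s j 2) m ∨
      ∃ r, W ≤ r ∧ r < 2 * W ∧ Compat (s i) r ∧ Compat (s j) r ∧
        Solvable Φ T (recolourFun W s i j r) m := by
  classical
  obtain ⟨S, col₀, h₀, rfl⟩ := h
  -- Normalising first makes every named colour in the colouring one that a demand mentions, so a
  -- name unused by the demands is also unused by the colouring.
  obtain ⟨col, h, hused⟩ := h₀.avoid (fun r => W ≤ r ∧ r < 2 * W ∧ ∃ l < W, s l = r)
    (fun v l hvl => by
      have hl : (l : ℕ) < W := hΦ v l hvl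
      rcases hs.label l hl with q | q | q
      · exact Or.inl q
      · exact Or.inr (Or.inl q)
      · exact Or.inr (Or.inr ⟨q.1, q.2, l, hl, rfl⟩))
  have dead : ∀ a : Fin w, (a : ℕ) < W → (∀ v, Φ.HasLabel v a → v ∈ S) →
      Solvable Φ T (Function.update s a 2) S.card := by
    intro a haW ha
    refine ⟨S, col, h.of_join ?_ ?_, rfl⟩
    · intro v l hvl hv h2 h0
      have : (l : ℕ) ≠ a := fun e => hv (ha v (Fin.ext e ▸ hvl))
      simp only [Function.update_of_ne this]
      exact ⟨h2, h0⟩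
    · intro r hr
      have : r ≠ a := by rintro rfl; exact hs.ne_one hW haW hr
      rwa [Function.update_of_ne this]
  by_cases hdi : ∀ v, Φ.HasLabel v i → v ∈ S
  · exact Or.inl (dead i hi hdi)
  by_cases hdj : ∀ v, Φ.HasLabel v j → v ∈ S
  · exact Or.inr (Or.inl (dead j hj hdj))
  right; right
  push Not at hdi hdj
  obtain ⟨u, hu, huS⟩ := hdi
  obtain ⟨v, hv, hvS⟩ := hdj
  -- The case `x = y` is needed since `i = j` is allowed.
  have hedge : ∀ x y, Φ.HasLabel x i → Φ.HasLabel y j → x ∉ S → y ∉ S → col x = col y := by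
    intro x y hx hy hxS hyS
    by_cases hxy : x = y
    · rw [hxy]
    · exact h.edge x y (Or.inr ⟨hxy, Or.inl ⟨hx, hy⟩⟩) hxS hyS
  have hci : ∀ x, Φ.HasLabel x i → x ∉ S → col x = col v := fun x hx hxS =>
    hedge x v hx hv hxS hvS
  have hcj : ∀ x, Φ.HasLabel x j → x ∉ S → col x = col v := fun x hx hxS =>
    (hedge u x hu hx huS hxS).symm.trans (hci u hu huS)
  have hli := h.lab u i hu huS
  have hlj := h.lab v j hv hvS
  rw [hci u hu huS] at hli
  rcases hκ : col v with r | o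
  · rw [hκ] at hli hlj hci hcj
    obtain ⟨h1, h2, h3⟩ := hused v r hκ
    have e1 : Compat (s i) r := by
      by_cases h0 : s i = 0
      · exact Or.inl h0
      · have := hli.2 h0
        simp only [Sum.inl.injEq] at this
        exact Or.inr this.symm
    have e2 : Compat (s j) r := by
      by_cases h0 : s j = 0
      · exact Or.inl h0
      · have := hlj.2 h0
        simp only [Sum.inl.injEq] at this
        exact Or.inr this.symm
    refine ⟨r, h1, h2, e1, e2, S, col, h.of_join ?_ ?_, rfl⟩
    · intro x l hxl hx hl2 hl0
      simp only [recolourFun, if_pos h3, Function.update_apply]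
      split_ifs with q q
      · exact ⟨by omega, fun _ => hcj x (Fin.ext q ▸ hxl) hx⟩
      · exact ⟨by omega, fun _ => hci x (Fin.ext q ▸ hxl) hx⟩
      · exact ⟨hl2, hl0⟩
    · intro q hq
      have hqi : q ≠ i := by rintro rfl; exact hs.ne_one hW hi hq
      have hqj : q ≠ j := by rintro rfl; exact hs.ne_one hW hj hq
      simpa only [recolourFun, if_pos h3, Function.update_of_ne hqi, Function.update_of_ne hqj]
        using hq
  · rw [hκ] at hli hlj hci hcj
    have hsi : s i = 0 := by
      by_contra h0
      simpa using hli.2 h0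
    have hsj : s j = 0 := by
      by_contra h0
      simpa using hlj.2 h0
    -- The common colour `.inr o` is not visible to the state, so both labels are free and its class
    -- can be renamed to a fresh `r`.
    obtain ⟨r, h1, h2, h3⟩ := exists_unused hi hsi
    have hu : ¬ ∃ l < W, s l = r := fun ⟨l, hl, hlr⟩ => h3 l hl hlr
    have hnr : ∀ x, col x ≠ .inl r := fun x hx => hu (hused x r hx).2.2
    have hone : ∀ q, s q = 1 → recolourFun W s i j r q = 1 := by
      intro q hq
      have hqi : q ≠ i := by rintro rfl; exact hs.ne_one hW hi hq
      have hqj : q ≠ j := by rintro rfl; exact hs.ne_one hW hj hq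
      simp only [recolourFun, if_neg hu, Function.update_apply, hqi, hqj, if_false]
      split_ifs
      · rfl
      · exact hq
    have hone' : recolourFun W s i j r r = 1 := by
      have hqi : r ≠ i := by omega
      have hqj : r ≠ j := by omega
      simp [recolourFun, if_neg hu, hqi, hqj]
    refine ⟨r, h1, h2, Or.inl hsi, Or.inl hsj, S, fun x => if col x = .inr o then .inl r else col x,
      ⟨h.sub, h.disj, ?_, ?_, ?_, ?_⟩, rfl⟩
    · intro x l hxl hx
      have hl := hΦ x l hxl
      have hlr : (l : ℕ) ≠ r := by omega
      have h5 := h.lab x l hxl hx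
      simp only [recolourFun, if_neg hu, Function.update_apply, hlr, if_false]
      by_cases q : (l : ℕ) = j
      · simp only [q, if_true, hcj x (Fin.ext q ▸ hxl) hx]
        exact ⟨by omega, fun _ => trivial⟩
      by_cases q' : (l : ℕ) = i
      · simp only [q', if_true, hci x (Fin.ext q' ▸ hxl) hx]
        refine ⟨?_, fun _ => ?_⟩ <;> split_ifs <;> first | rfl | omega
      · simp only [q, q', if_false]
        refine ⟨h5.1, fun h0 => ?_⟩
        simp [h5.2 h0]
    · intro x y hxy hx hy
      simp only [h.edge x y (Or.inl hxy) hx hy]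
    · intro t ht htv
      by_cases hto : col t = .inr o
      · right; exact ⟨r, by simp [hto], hone'⟩
      · simp only [if_neg hto]
        rcases h.term t ht htv with q | ⟨q, q1, q2⟩
        · exact Or.inl q
        · exact Or.inr ⟨q, q1, hone q q2⟩
    · intro t ht htv t' ht' htv' q hq hq'
      -- The renamed class has at most one terminal, because `.inr o` can only be the private colour
      -- of the terminal recorded in `o`.
      have key : ∀ t ∈ T, t ∈ Φ.verts → col t = .inr o → o = some t := by
        intro t ht htv hto
        rcases h.term t ht htv with q | ⟨q, q1, q2⟩
        · rw [hto] at q; simpa using q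
        · rw [hto] at q1; simp at q1
      by_cases hto : col t = .inr o <;> by_cases hto' : col t' = .inr o
      · have a1 := key t ht htv hto
        have a2 := key t' ht' htv' hto'
        rw [a1] at a2
        simpa using a2
      · simp only [hto, hto', if_true, if_false] at hq hq'
        cases hq
        exact absurd hq' (hnr t')
      · simp only [hto, hto', if_true, if_false] at hq hq'
        cases hq'
        exact absurd hq (hnr t)
      · simp only [hto, hto', if_false] at hq hq'
        exact h.inj t ht htv t' ht' htv' q hq hq'

end semantics

/-! ### Correctness of the dynamic program -/

/-- The state given by a list of digits. -/
def digit (st : List ℕ) (r : ℕ) : ℕ := st.getD r 0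

theorem digit_set {st : List ℕ} {i x : ℕ} (hi : i < st.length) :
    digit (st.set i x) = Function.update (digit st) i x := by
  funext r
  unfold digit
  by_cases h : r = i
  · subst h; simp [hi]
  · simp [h, Ne.symm h]

theorem digit_mem {st : List ℕ} {r : ℕ} : r ∈ st ↔ ∃ l < st.length, digit st l = r := by
  unfold digit
  rw [List.mem_iff_getElem]
  constructor
  · rintro ⟨l, hl, rfl⟩
    exact ⟨l, hl, by simp [hl]⟩
  · rintro ⟨l, hl, h⟩
    exact ⟨l, hl, by simpa [hl] using h⟩

/-- Well-formed lists of digits. -/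
structure ProperList (W : ℕ) (st : List ℕ) : Prop where
  len : st.length = 2 * W
  proper : Proper W (digit st)

theorem ProperList.set {W : ℕ} {st : List ℕ} (h : ProperList W st) {i x : ℕ} (hi : i < W)
    (hx : x = 0 ∨ x = 2 ∨ (W ≤ x ∧ x < 2 * W)) : ProperList W (st.set i x) := by
  refine ⟨by simp [h.len], ?_⟩
  rw [digit_set (by have := h.len; omega)]
  constructor
  · intro l hl
    rw [Function.update_apply]
    split_ifs
    · exact hx
    · exact h.proper.label l hl
  · intro r hr
    rw [Function.update_of_ne (by omega)]
    exact h.proper.mark r hr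

theorem ProperList.set_mark {W : ℕ} {st : List ℕ} (h : ProperList W st) {r : ℕ} (hr : W ≤ r)
    (hr' : r < 2 * W) : ProperList W (st.set r 1) := by
  refine ⟨by simp [h.len], ?_⟩
  rw [digit_set (by have := h.len; omega)]
  constructor
  · intro l hl
    rw [Function.update_of_ne (by omega)]
    exact h.proper.label l hl
  · intro q hq
    rw [Function.update_apply]
    split_ifs
    · exact Or.inr rfl
    · exact h.proper.mark q hq

theorem ProperList.recolour {W : ℕ} {st : List ℕ} (h : ProperList W st) {i j r : ℕ} (hi : i < W)
    (hj : j < W) (hr : W ≤ r) (hr' : r < 2 * W) : ProperList W (recolour st i j r) := by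
  unfold MultiwayCut.recolour
  refine ProperList.set (ProperList.set ?_ hi (by omega)) hj (by omega)
  split_ifs
  · exact h
  · exact h.set_mark hr hr'

/-- The test `r ∈ st` scans the whole list, but the digits from position `W` on are at most `1` and
`3 ≤ W ≤ r`, so it sees label digits only. -/
theorem digit_recolour {W : ℕ} {st : List ℕ} (h : ProperList W st) {i j r : ℕ} (hW : 3 ≤ W)
    (hi : i < W) (hj : j < W) (hr : W ≤ r) (hr' : r < 2 * W) :
    digit (recolour st i j r) = recolourFun W (digit st) i j r := by
  have hmem : r ∈ st ↔ ∃ l < W, digit st l = r := by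
    rw [digit_mem]
    constructor
    · rintro ⟨l, hl, hlr⟩
      refine ⟨l, ?_, hlr⟩
      by_contra! hc
      have := h.proper.mark l hc
      omega
    · rintro ⟨l, hl, hlr⟩
      exact ⟨l, by have := h.len; omega, hlr⟩
  have := h.len
  unfold recolour recolourFun
  by_cases hu : r ∈ st
  · rw [if_pos hu, if_pos (hmem.1 hu), digit_set (by simp; omega), digit_set (by omega)]
  · rw [if_neg hu, if_neg (fun h' => hu (hmem.2 h')), digit_set (by simp; omega),
      digit_set (by simp; omega), digit_set (by omega)]

theorem isLeastCost_joinCost {Q : List ℕ → ℕ → Prop} {f : List ℕ → ℕ} {st : List ℕ}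
    {i j : ℕ} (m r : ℕ)
    (hf : ∀ q, r ≤ q → q < r + m → IsLeastCost (Q (recolour st i j q)) (f (recolour st i j q))) :
    IsLeastCost (fun c => ∃ q, r ≤ q ∧ q < r + m ∧ Compat (digit st i) q ∧ Compat (digit st j) q ∧
      Q (recolour st i j q) c) (joinCost f st i j m r) := by
  induction m generalizing r with
  | zero => exact isLeastCost_false fun m ⟨q, h1, h2, _⟩ => by omega
  | succ m ih =>
    have h1 : IsLeastCost (fun c => Compat (digit st i) r ∧ Compat (digit st j) r ∧
        Q (recolour st i j r) c) (if Compat (st.getD i 0) r then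
        if Compat (st.getD j 0) r then f (recolour st i j r) else 0 else 0) := by
      split_ifs with h1 h2
      · exact (hf r le_rfl (by omega)).congr fun c => ⟨fun h => h.2.2, fun h => ⟨h1, h2, h⟩⟩
      · exact isLeastCost_false fun c h => h2 h.2.1
      · exact isLeastCost_false fun c h => h1 h.1
    refine (h1.min (ih (r + 1) fun q h1 h2 => hf q (by omega) (by omega))).congr fun c => ?_
    constructor
    · rintro ⟨q, h1, h2, h3⟩
      by_cases hq : q = r
      · subst hq; exact Or.inl h3
      · exact Or.inr ⟨q, by omega, by omega, h3⟩
    · rintro (h | ⟨q, h1, h2, h3⟩)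
      · exact ⟨r, le_rfl, by omega, h⟩
      · exact ⟨q, by omega, by omega, h3⟩

/-- The digits `1` are distributed. -/
inductive ListSplits : List ℕ → List ℕ → List ℕ → Prop
  | nil : ListSplits [] [] []
  | left {st s₁ s₂ : List ℕ} : ListSplits st s₁ s₂ → ListSplits (1 :: st) (1 :: s₁) (0 :: s₂)
  | right {st s₁ s₂ : List ℕ} : ListSplits st s₁ s₂ → ListSplits (1 :: st) (0 :: s₁) (1 :: s₂)
  | other {d : ℕ} {st s₁ s₂ : List ℕ} : d ≠ 1 → ListSplits st s₁ s₂ →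
      ListSplits (d :: st) (d :: s₁) (d :: s₂)

theorem ListSplits.length {st s₁ s₂ : List ℕ} (h : ListSplits st s₁ s₂) :
    s₁.length = st.length ∧ s₂.length = st.length := by
  induction h <;> simp_all

theorem ListSplits.splits {st s₁ s₂ : List ℕ} (h : ListSplits st s₁ s₂) :
    Splits (digit st) (digit s₁) (digit s₂) := by
  induction h with
  | nil => intro r; simp [digit]
  | left _ ih | right _ ih =>
    rintro (_ | r)
    · simp [digit]
    · exact ih r
  | other hd _ ih =>
    rintro (_ | r)
    · exact Or.inr (Or.inr ⟨hd, rfl, rfl⟩)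
    · exact ih r

/-- Realises a prescribed set `A` of permissions for the left side by an actual pair of lists, one
digit at a time. -/
theorem exists_listSplits (st : List ℕ) (A : ℕ → Prop) :
    ∃ s₁ s₂, ListSplits st s₁ s₂ ∧ ∀ r, digit st r = 1 → (A r ↔ digit s₁ r = 1) := by
  induction st generalizing A with
  | nil => exact ⟨[], [], .nil, fun r hr => by simp [digit] at hr⟩
  | cons d st ih =>
    obtain ⟨s₁, s₂, h, hA⟩ := ih fun r => A (r + 1)
    by_cases hd : d = 1
    · subst hd
      by_cases h0 : A 0
      · refine ⟨_, _, .left h, ?_⟩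
        rintro (_ | r) hr
        · simpa [digit] using h0
        · exact hA r hr
      · refine ⟨_, _, .right h, ?_⟩
        rintro (_ | r) hr
        · simpa [digit] using h0
        · exact hA r hr
    · refine ⟨_, _, .other hd h, ?_⟩
      rintro (_ | r) hr
      · exact absurd hr hd
      · exact hA r hr

theorem ListSplits.proper {W : ℕ} {st s₁ s₂ : List ℕ} (h : ListSplits st s₁ s₂) (hW : 3 ≤ W)
    (hst : ProperList W st) : ProperList W s₁ ∧ ProperList W s₂ := by
  have hs := h.splits
  have key : ∀ r, (digit s₁ r = digit st r ∧ digit s₂ r = digit st r) ∨ (digit st r = 1 ∧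
      (digit s₁ r = 0 ∨ digit s₁ r = 1) ∧ (digit s₂ r = 0 ∨ digit s₂ r = 1)) := fun r => by
    rcases hs r with h | h | h <;> omega
  refine ⟨⟨h.length.1.trans hst.len, fun l hl => ?_, fun r hr => ?_⟩,
    ⟨h.length.2.trans hst.len, fun l hl => ?_, fun r hr => ?_⟩⟩
  · have := hst.proper.label l hl
    have := key l
    omega
  · have := hst.proper.mark r hr
    have := key r
    omega
  · have := hst.proper.label l hl
    have := key l
    omega
  · have := hst.proper.mark r hr
    have := key r
    omega

/-- The recursion moves consumed digits into `f` and `g` as prefixes, so the induction has to vary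
`Q` and `R` along with them. -/
theorem isLeastCost_splitCost {Q R : List ℕ → ℕ → Prop} (st : List ℕ) (f g : List ℕ → ℕ)
    (h : ∀ s₁ s₂, ListSplits st s₁ s₂ → IsLeastCost (Q s₁) (f s₁) ∧ IsLeastCost (R s₂) (g s₂)) :
    IsLeastCost (fun m => ∃ s₁ s₂ k l, ListSplits st s₁ s₂ ∧ m = k + l ∧ Q s₁ k ∧ R s₂ l)
      (splitCost st f g) := by
  induction st generalizing Q R f g with
  | nil =>
    have := h _ _ .nil
    refine (this.1.add this.2).congr fun m => ⟨?_, ?_⟩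
    · rintro ⟨s₁, s₂, k, l, ⟨⟩, h⟩
      exact ⟨k, l, h⟩
    · rintro ⟨k, l, h⟩
      exact ⟨_, _, k, l, .nil, h⟩
  | cons d st ih =>
    unfold splitCost
    split_ifs with hd
    · subst hd
      refine ((ih (Q := fun s => Q (1 :: s)) (R := fun s => R (0 :: s)) _ _
        fun s₁ s₂ hs => h _ _ (.left hs)).min
        (ih (Q := fun s => Q (0 :: s)) (R := fun s => R (1 :: s)) _ _
        fun s₁ s₂ hs => h _ _ (.right hs))).congr fun m => ⟨?_, ?_⟩
      · rintro ⟨s₁, s₂, k, l, hs, h⟩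
        cases hs with
        | left hs => exact Or.inl ⟨_, _, k, l, hs, h⟩
        | right hs => exact Or.inr ⟨_, _, k, l, hs, h⟩
        | other hd => exact absurd rfl hd
      · rintro (⟨s₁, s₂, k, l, hs, h⟩ | ⟨s₁, s₂, k, l, hs, h⟩)
        · exact ⟨_, _, k, l, .left hs, h⟩
        · exact ⟨_, _, k, l, .right hs, h⟩
    · refine (ih (Q := fun s => Q (d :: s)) (R := fun s => R (d :: s)) _ _
        fun s₁ s₂ hs => h _ _ (.other hd hs)).congr fun m => ⟨?_, ?_⟩
      · rintro ⟨s₁, s₂, k, l, hs, h⟩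
        cases hs with
        | left hs => exact absurd rfl hd
        | right hs => exact absurd rfl hd
        | other _ hs => exact ⟨_, _, k, l, hs, h⟩
      · rintro ⟨s₁, s₂, k, l, hs, h⟩
        exact ⟨_, _, k, l, .other hd hs, h⟩

theorem le_maxLabel {n w : ℕ} {Φ : WExpr (Fin n) w} {v : Fin n} {l : Fin w}
    (h : Φ.HasLabel v l) : (l : ℕ) ≤ maxLabel Φ := by
  induction Φ generalizing l with
  | intro i u => simp [maxLabel, h.2]
  | union a b iha ihb =>
    rcases h with h | h
    · exact (iha h).trans (le_max_left _ _)
    · exact (ihb h).trans (le_max_right _ _)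
  | rename i j a ih =>
    simp only [maxLabel]
    rcases h with h | h
    · have := ih h.1; omega
    · rw [h.2]; omega
  | join i j a ih =>
    simp only [maxLabel]
    have := ih h; omega

/-- Induction over the expression, one transfer lemma per operation; each child state is again
well-formed. -/
theorem isLeastCost_cost {n w W : ℕ} (T : Finset (Fin n)) (Φ : WExpr (Fin n) w) (hΦ : Φ.Valid)
    (hW : maxLabel Φ + 3 ≤ W) (st : List ℕ) (hst : ProperList W st) :
    IsLeastCost (Solvable Φ T (digit st)) (cost W T Φ st) := by
  induction Φ generalizing st with
  | intro i v =>
    simp only [maxLabel] at hW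
    have h1 := hst.proper.label i (by omega)
    unfold cost introCost
    change IsLeastCost _ (if v ∈ T then if digit st i = 0 then 1 else if digit st i ≤ 2 then 0 else
      if digit st (digit st i) = 0 then 0 else 1 else
      if digit st i = 0 then 1 else if digit st i ≤ 2 then 2 else 1)
    have h2 : 2 < digit st i → digit st (digit st i) = 0 ∨ digit st (digit st i) = 1 :=
      fun h => hst.proper.mark _ (by omega)
    refine IsLeastCost.congr ?_ fun m => solvable_intro
    constructor
    · rintro m (⟨rfl, h3, h4⟩ | ⟨rfl, h3⟩)
      · by_cases hv : v ∈ T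
        · have := h4 hv
          simp only [hv, if_true]
          split_ifs <;> omega
        · simp only [hv, if_false]
          split_ifs <;> omega
      · simp only [h3, if_false]
        split_ifs <;> omega
    · intro h
      split_ifs at h ⊢ with a1 a2 a3 a4 a5 a6
      · exact Or.inl ⟨rfl, by omega, fun _ => Or.inl a2⟩
      · exact absurd rfl h
      · exact absurd rfl h
      · exact Or.inl ⟨rfl, by omega, fun _ => Or.inr (by omega)⟩
      · exact Or.inl ⟨rfl, by omega, fun h' => absurd h' a1⟩
      · exact Or.inr ⟨rfl, a1⟩
      · exact Or.inl ⟨rfl, by omega, fun h' => absurd h' a1⟩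
  | union a b iha ihb =>
    obtain ⟨ha, hb, hd⟩ := hΦ
    simp only [maxLabel] at hW
    unfold cost
    refine (isLeastCost_splitCost (Q := fun s => Solvable a T (digit s))
      (R := fun s => Solvable b T (digit s)) st _ _ fun s₁ s₂ hs =>
      ⟨iha ha (by omega) _ (hs.proper (by omega) hst).1,
        ihb hb (by omega) _ (hs.proper (by omega) hst).2⟩).congr fun m => ?_
    have hab : ∀ v l, (WExpr.union a b).HasLabel v l → digit st l ≠ 1 := fun v l h => by
      have := le_maxLabel h
      simp only [maxLabel] at this
      exact hst.proper.ne_one (by omega) (by omega)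
    constructor
    · intro h
      obtain ⟨A, hA⟩ := exists_of_solvable_union hd hab h
      obtain ⟨s₁, s₂, hs, hA'⟩ := exists_listSplits st A
      obtain ⟨k, l, h⟩ := hA _ _ hs.splits hA'
      exact ⟨s₁, s₂, k, l, hs, h⟩
    · rintro ⟨s₁, s₂, k, l, hs, rfl, h1, h2⟩
      exact solvable_union_of hd hs.splits hab h1 h2
  | rename i j a ih =>
    simp only [maxLabel] at hW
    have hi : (i : ℕ) < W := by omega
    have hj : (j : ℕ) < W := by omega
    have := hst.len
    unfold cost
    refine (ih hΦ (by omega) _ (hst.set hi (hst.proper.label j hj))).congr fun m => ?_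
    rw [digit_set (by omega)]
    exact solvable_rename (hst.proper.ne_one (by omega) hi) (hst.proper.ne_one (by omega) hj)
  | join i j a ih =>
    simp only [maxLabel] at hW
    have hi : (i : ℕ) < W := by omega
    have hj : (j : ℕ) < W := by omega
    have hlen := hst.len
    have hlab : ∀ v l, a.HasLabel v l → (l : ℕ) < W := fun v l h => by
      have := le_maxLabel h
      omega
    unfold cost
    refine ((ih hΦ (by omega) _ (hst.set hi (by omega))).min
      ((ih hΦ (by omega) _ (hst.set hj (by omega))).min
      (isLeastCost_joinCost (Q := fun s => Solvable a T (digit s)) W W fun q h1 h2 =>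
        ih hΦ (by omega) _ (hst.recolour hi hj h1 (by omega))))).congr fun m => ?_
    rw [digit_set (by omega), digit_set (by omega)]
    constructor
    · intro h
      rcases cases_of_solvable_join hst.proper (by omega) hlab hi hj h with h | h | ⟨r, h1, h2, h3, h4, h⟩
      · exact Or.inl h
      · exact Or.inr (Or.inl h)
      · refine Or.inr (Or.inr ⟨r, h1, by omega, h3, h4, ?_⟩)
        rwa [digit_recolour hst (by omega) hi hj h1 h2]
    · rintro (h | h | ⟨r, h1, h2, h3, h4, h⟩)
      · exact solvable_join_of_dead (Or.inl rfl) h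
      · exact solvable_join_of_dead (Or.inr rfl) h
      · rw [digit_recolour hst (by omega) hi hj h1 (by omega)] at h
        exact solvable_join_of_recolour (by omega) hlab h1 h3 h4 h hi hj

-- From the empty demand to multiway cuts

/-- Without permissions every terminal has its private colour, and colours are constant along walks
that avoid `S`. Conversely, a vertex gets the colour of a terminal that reaches it outside `S`, if
there is one. -/
theorem exists_solvable_iff {V : Type} [DecidableEq V] [Fintype V] {w : ℕ} {G : SimpleGraph V}
    {Φ : WExpr V w} {T : Finset V} (h : Φ.IsExpressionOf G) (k : ℕ) :
    (∃ m ≤ k, Solvable Φ T (fun _ => 0) m) ↔ NodeMultiwayCut G T k := by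
  classical
  obtain ⟨_, hv, rfl⟩ := h
  constructor
  · rintro ⟨_, hm, S, col, h, rfl⟩
    refine ⟨S, hm, h.disj, fun s hs t ht hst p => ?_⟩
    by_contra! hp
    have key : ∀ u v (p : Φ.graph.Walk u v), (∀ x ∈ p.support, x ∉ S) → col u = col v := by
      intro u v p
      induction p with
      | nil => intro _; rfl
      | cons huv p ih =>
        intro hp
        simp only [SimpleGraph.Walk.support_cons, List.mem_cons, forall_eq_or_imp] at hp
        exact (h.edge _ _ huv hp.1 (hp.2 _ p.start_mem_support)).trans (ih hp.2)
    have := key s t p hp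
    rcases h.term s hs (by simp [hv]) with a | ⟨r, _, a⟩
    · rcases h.term t ht (by simp [hv]) with b | ⟨r, _, b⟩
      · rw [a, b] at this
        exact hst (by simpa using this)
      · simp at b
    · simp at a
  · rintro ⟨S, hS, hd, h⟩
    let R : V → V → Prop := fun u v => ∃ p : Φ.graph.Walk u v, ∀ x ∈ p.support, x ∉ S
    refine ⟨_, hS, S, fun v => if h : ∃ t ∈ T, R t v then .inr (some h.choose) else .inr none,
      ⟨by simp [hv], hd, by simp, ?_, ?_, ?_⟩, rfl⟩
    · intro u v huv hu hv
      have e : ∀ u v, Φ.graph.Adj u v → u ∉ S → v ∉ S → ∀ t, R t u → R t v := by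
        rintro u v huv hu hv t ⟨p, hp⟩
        refine ⟨p.concat huv, fun x hx => ?_⟩
        rw [SimpleGraph.Walk.support_concat] at hx
        simp only [List.mem_append, List.mem_singleton] at hx
        rcases hx with hx | rfl
        · exact hp x hx
        · exact hv
      have : ∀ t, R t u ↔ R t v := fun t => ⟨e u v huv hu hv t, e v u huv.symm hv hu t⟩
      simp only [this]
    · intro t ht _
      left
      have hex : ∃ t' ∈ T, R t' t :=
        ⟨t, ht, .nil, by simpa using fun h' => Finset.disjoint_left.1 hd h' ht⟩
      -- The chosen terminal reaches `t` outside `S`, so by the cut property it is `t` itself.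
      have hc := hex.choose_spec
      have : hex.choose = t := by
        by_contra hne
        obtain ⟨p, hp⟩ := hc.2
        obtain ⟨x, hx, hxS⟩ := h _ hc.1 t ht hne p
        exact hp x hx hxS
      simp only [dif_pos hex, this]
    · intro t _ _ t' _ _ r hr
      split_ifs at hr

theorem properList_replicate (W : ℕ) : ProperList W (List.replicate (2 * W) 0) := by
  refine ⟨by simp, ⟨fun l _ => ?_, fun r _ => ?_⟩⟩ <;> left <;>
    simp [digit, List.getD_eq_getElem?_getD, List.getElem?_replicate] <;> split_ifs <;> rfl

theorem cost_le_iff {n w W k : ℕ} {G : SimpleGraph (Fin n)} {T : Finset (Fin n)}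
    {Φ : WExpr (Fin n) w} (hΦ : Φ.IsExpressionOf G) (hW : maxLabel Φ + 3 ≤ W) :
    (cost W T Φ (List.replicate (2 * W) 0) ≠ 0 ∧ cost W T Φ (List.replicate (2 * W) 0) ≤ k + 1) ↔
      NodeMultiwayCut G T k := by
  rw [← exists_solvable_iff hΦ]
  have h := isLeastCost_cost T Φ hΦ.1 hW _ (properList_replicate W)
  have e : digit (List.replicate (2 * W) 0) = fun _ => 0 := by
    funext r
    simp [digit, List.getD_eq_getElem?_getD, List.getElem?_replicate]
    split_ifs <;> rfl
  rw [e] at h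
  constructor
  · rintro ⟨h1, h2⟩
    exact ⟨_, by omega, h.2 h1⟩
  · rintro ⟨m, hm, h'⟩
    have := h.1 m h'
    omega

/-! ### The program -/

/-- The variable `0`. -/
abbrev arg : Expr := .var 0

/-- The numeral `1`, which also stands for "yes". -/
abbrev oneExpr : Expr := .cons .nil .nil

/-- `(l, d) ↦ l` without its first `d` elements -/
def dropBody : Expr :=
  .ite (.tail arg) (.call 0 (.cons (.tail (.head arg)) (.tail (.tail arg)))) (.head arg)

/-- the `d`-th element of `l` -/
abbrev nthExpr (l d : Expr) : Expr := .head (.call 0 (.cons l d))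

/-- `(l, i, x) ↦ l` with `x` at position `i` -/
def setBody : Expr :=
  .ite (.head (.tail arg))
    (.cons (.head (.head arg)) (.call 1 (.cons (.tail (.head arg))
      (.cons (.tail (.head (.tail arg))) (.tail (.tail arg))))))
    (.cons (.tail (.tail arg)) (.tail (.head arg)))

/-- `l` with `x` at position `i` -/
abbrev setExpr (l i x : Expr) : Expr := .call 1 (.cons l (.cons i x))

/-- `(x, y) ↦ x = y` -/
def eqBody : Expr :=
  .ite (.head arg)
    (.ite (.tail arg) (.call 2 (.cons (.tail (.head arg)) (.tail (.tail arg)))) .nil)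
    (.ite (.tail arg) .nil oneExpr)

/-- `(x, l) ↦ x ∈ l` -/
def memBody : Expr :=
  .ite (.tail arg)
    (.ite (.call 2 (.cons (.head arg) (.head (.tail arg)))) oneExpr
      (.call 3 (.cons (.head arg) (.tail (.tail arg))))) .nil

/-- `(t, st) ↦` the entry of the table `t` for the state `st` -/
def lookupBody : Expr :=
  .ite (.tail arg)
    (.call 4 (.cons (nthExpr (.head arg) (.head (.tail arg))) (.tail (.tail arg)))) (.head arg)

/-- `(x, y) ↦ x ≤ y` -/
def leBody : Expr :=
  .ite (.head arg)
    (.ite (.tail arg) (.call 5 (.cons (.tail (.head arg)) (.tail (.tail arg)))) .nil) oneExpr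

/-- minimum of two costs -/
def minBody : Expr :=
  .ite (.head arg)
    (.ite (.tail arg) (.ite (.call 5 arg) (.head arg) (.tail arg)) (.head arg)) (.tail arg)

/-- `(x, y) ↦ x + y` -/
def plusBody : Expr :=
  .ite (.head arg) (.cons .nil (.call 7 (.cons (.tail (.head arg)) (.tail arg)))) (.tail arg)

/-- sum of two costs -/
def addBody : Expr :=
  .ite (.head arg)
    (.ite (.tail arg) (.call 7 (.cons (.tail (.head arg)) (.tail arg))) .nil) .nil

/-- `((X, Y), st) ↦` cost of a union, where `X` and `Y` are the tables of the operands -/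
def splitBody : Expr :=
  .ite (.tail arg)
    (.ite (.call 2 (.cons (.head (.tail arg)) oneExpr))
      (.call 6 (.cons
        (.call 9 (.cons (.cons (.head (.tail (.head (.head arg)))) (.head (.tail (.head arg))))
          (.tail (.tail arg))))
        (.call 9 (.cons (.cons (.head (.head (.head arg))) (.head (.tail (.tail (.head arg)))))
          (.tail (.tail arg))))))
      (.call 9 (.cons
        (.cons (nthExpr (.head (.head arg)) (.head (.tail arg)))
          (nthExpr (.tail (.head arg)) (.head (.tail arg))))
        (.tail (.tail arg)))))
    (.call 8 (.head arg))

/-- `((X, st, i, j), l, r) ↦` least cost over the colours `r, …, r + length l - 1` -/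
def joinBody : Expr :=
  .ite (.head (.tail arg))
    (.call 6 (.cons
      (.ite (.call 11 (.cons (nthExpr (.head (.tail (.head arg)))
          (.head (.tail (.tail (.head arg))))) (.tail (.tail arg))))
        (.ite (.call 11 (.cons (nthExpr (.head (.tail (.head arg)))
            (.tail (.tail (.tail (.head arg))))) (.tail (.tail arg))))
          (.call 4 (.cons (.head (.head arg))
            (.call 12 (.cons (.head (.tail (.head arg))) (.cons (.head (.tail (.tail (.head arg))))
              (.cons (.tail (.tail (.tail (.head arg)))) (.tail (.tail arg))))))))
          .nil) .nil)
      (.call 10 (.cons (.head arg) (.cons (.tail (.head (.tail arg)))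
        (.cons .nil (.tail (.tail arg))))))))
    .nil

/-- `(d, r) ↦` whether the demand `d` allows colour `r` -/
def compatBody : Expr := .ite (.head arg) (.call 2 arg) oneExpr

/-- `(st, i, j, r) ↦ recolour st i j r` -/
def recolourBody : Expr :=
  setExpr (setExpr
      (.ite (.call 3 (.cons (.tail (.tail (.tail arg))) (.head arg))) (.head arg)
        (setExpr (.head arg) (.tail (.tail (.tail arg))) oneExpr))
      (.head (.tail arg)) (.tail (.tail (.tail arg))))
    (.head (.tail (.tail arg))) (.tail (.tail (.tail arg)))

/-- `((T, i, v), st) ↦` cost of a single vertex -/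
def introBody : Expr :=
  .bind (nthExpr (.tail arg) (.head (.tail (.head arg))))
    (.ite (.call 3 (.cons (.tail (.tail (.head (.var 1)))) (.head (.head (.var 1)))))
      (.ite arg (.ite (.tail (.tail arg))
        (.ite (nthExpr (.tail (.var 1)) arg) oneExpr .nil) .nil) oneExpr)
      (.ite arg (.ite (.tail (.tail arg)) oneExpr (.cons .nil oneExpr)) oneExpr))

/-- `((i, j, X), st) ↦` cost of a renaming, where `X` is the table of the operand -/
def renameBody : Expr :=
  .call 4 (.cons (.tail (.tail (.head arg)))
    (setExpr (.tail arg) (.head (.head arg)) (nthExpr (.tail arg) (.head (.tail (.head arg))))))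

/-- `((W, i, j, X), st) ↦` cost of a join, where `X` is the table of the operand -/
def joinAllBody : Expr :=
  .call 6 (.cons
    (.call 4 (.cons (.tail (.tail (.tail (.head arg))))
      (setExpr (.tail arg) (.head (.tail (.head arg))) (.cons .nil oneExpr))))
    (.call 6 (.cons
      (.call 4 (.cons (.tail (.tail (.tail (.head arg))))
        (setExpr (.tail arg) (.head (.tail (.tail (.head arg)))) (.cons .nil oneExpr))))
      (.call 10 (.cons
        (.cons (.tail (.tail (.tail (.head arg)))) (.cons (.tail arg)
          (.cons (.head (.tail (.head arg))) (.head (.tail (.tail (.head arg)))))))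
        (.cons (.call 0 (.cons (.tail arg) (.head (.head arg)))) (.head (.head arg))))))))

/-- `(((W, T), node), st) ↦` entry for `st` in the table of `node` -/
def leafBody : Expr :=
  .ite (.head (.tail (.head arg)))
    (.ite (.tail (.head (.tail (.head arg))))
      (.ite (.tail (.tail (.head (.tail (.head arg)))))
        (.call 22 (.cons (.cons (.head (.head (.head arg))) (.tail (.tail (.head arg))))
          (.tail arg)))
        (.call 21 (.cons (.tail (.tail (.head arg))) (.tail arg))))
      (.call 9 (.cons (.tail (.tail (.head arg))) (.tail arg))))
    (.call 15 (.cons (.cons (.tail (.head (.head arg))) (.tail (.tail (.head arg)))) (.tail arg)))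

/-- `(l, acc) ↦` the reverse of `l`, followed by `acc` -/
def revBody : Expr :=
  .ite (.head arg)
    (.call 14 (.cons (.tail (.head arg)) (.cons (.head (.head arg)) (.tail arg)))) (.tail arg)

/-- `(ctx, bs, d, pre) ↦` table of all states that start with the reverse of `pre`; the digits that
follow are bounded by `bs`, and the first of them starts at `d` -/
def buildBody : Expr :=
  .ite (.head (.tail arg))
    (.ite (.head (.head (.tail arg)))
      (.cons
        (.call 16 (.cons (.head arg) (.cons (.tail (.head (.tail arg)))
          (.cons .nil (.cons (.head (.tail (.tail arg))) (.tail (.tail (.tail arg))))))))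
        (.call 16 (.cons (.head arg) (.cons
          (.cons (.tail (.head (.head (.tail arg)))) (.tail (.head (.tail arg))))
          (.cons (.cons .nil (.head (.tail (.tail arg)))) (.tail (.tail (.tail arg))))))))
      .nil)
    (.call 13 (.cons (.head arg) (.call 14 (.cons (.tail (.tail (.tail arg))) .nil))))

/-- `((bs, env), Ψ) ↦` table of `Ψ` -/
def solveBody : Expr :=
  .bind
    (.ite (.head (.tail arg))
      (.ite (.tail (.head (.tail arg)))
        (.cons (.head (.tail arg)) (.cons (.head (.tail (.tail arg)))
          (.cons (.head (.tail (.tail (.tail arg))))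
            (.call 17 (.cons (.head arg) (.tail (.tail (.tail (.tail arg)))))))))
        (.cons (.head (.tail arg)) (.cons
          (.call 17 (.cons (.head arg) (.head (.tail (.tail arg)))))
          (.call 17 (.cons (.head arg) (.tail (.tail (.tail arg))))))))
      (.tail arg))
    (.call 16 (.cons (.cons (.tail (.head (.var 1))) arg)
      (.cons (.head (.head (.var 1))) (.cons .nil .nil))))

/-- `(x, y) ↦ max x y` -/
def maxBody : Expr :=
  .ite (.head arg)
    (.ite (.tail arg) (.cons .nil (.call 18 (.cons (.tail (.head arg)) (.tail (.tail arg)))))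
      (.head arg)) (.tail arg)

/-- `Ψ ↦` largest label -/
def maxLabelBody : Expr :=
  .ite (.head arg)
    (.ite (.tail (.head arg))
      (.call 18 (.cons (.head (.tail arg)) (.call 18 (.cons (.head (.tail (.tail arg)))
        (.call 19 (.tail (.tail (.tail arg))))))))
      (.call 18 (.cons (.call 19 (.head (.tail arg))) (.call 19 (.tail (.tail arg))))))
    (.head (.tail arg))

/-- `(m, x, acc) ↦ m` copies of `x`, followed by `acc` -/
def repBody : Expr :=
  .ite (.head arg)
    (.cons (.head (.tail arg)) (.call 20 (.cons (.tail (.head arg)) (.tail arg))))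
    (.tail (.tail arg))

/-- The main expression. -/
def mainBody : Expr :=
  .bind (.cons .nil (.cons .nil (.cons .nil (.call 19 (.head arg)))))
    (.bind (.call 7 (.cons arg arg))
      (.bind (.call 20 (.cons (.var 1) (.cons arg
          (.call 20 (.cons (.var 1) (.cons (.cons .nil oneExpr) .nil))))))
        (.bind (.call 4 (.cons
            (.call 17 (.cons (.cons arg (.cons (.var 2) (.head (.tail (.var 3)))))
              (.head (.var 3))))
            (.call 20 (.cons (.var 1) (.cons .nil .nil)))))
          (.ite arg (.call 5 (.cons arg (.cons .nil (.tail (.tail (.var 4)))))) .nil))))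

/-- The program. -/
def prog : Program where
  main := mainBody
  funs := [dropBody, setBody, eqBody, memBody, lookupBody, leBody, minBody, plusBody, addBody,
    splitBody, joinBody, compatBody, recolourBody, leafBody, revBody, introBody, buildBody,
    solveBody, maxBody, maxLabelBody, repBody, renameBody, joinAllBody]

/-! ### Reasoning about evaluations -/

/-- The expression `e` evaluates to a value and in a time that satisfy `Q`. -/
def WP (ρ : List Val) (e : Expr) (Q : Val → ℕ → Prop) : Prop :=
  ∃ v t, Eval prog ρ e v t ∧ Q v t

/-- The call of function `f` with argument `u` yields a value and a time that satisfy `Q`. -/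
def CallWP (f : ℕ) (u : Val) (Q : Val → ℕ → Prop) : Prop :=
  ∃ body, prog.funs[f]? = some body ∧ WP [u] body Q

/-- The call of function `f` with argument `u` yields `v` within time `T`. -/
def Spec (f : ℕ) (u v : Val) (T : ℕ) : Prop :=
  CallWP f u fun v' t => v' = v ∧ t ≤ T

-- This and the following rules let `simp` execute a function body symbolically; it stops at each
-- `CallWP`, where the specification of the callee is supplied by `Spec.use`.
@[simp]
theorem wp_var {ρ : List Val} {i : ℕ} {Q : Val → ℕ → Prop} :
    WP ρ (.var i) Q ↔ Q (ρ.getD i .nil) 1 :=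
  ⟨fun ⟨_, _, h, hQ⟩ => by cases h; exact hQ, fun h => ⟨_, _, .var _ _, h⟩⟩

@[simp]
theorem wp_nil {ρ : List Val} {Q : Val → ℕ → Prop} : WP ρ .nil Q ↔ Q .nil 1 :=
  ⟨fun ⟨_, _, h, hQ⟩ => by cases h; exact hQ, fun h => ⟨_, _, .nil _, h⟩⟩

@[simp]
theorem wp_cons {ρ : List Val} {a b : Expr} {Q : Val → ℕ → Prop} :
    WP ρ (.cons a b) Q ↔ WP ρ a fun u s => WP ρ b fun v t => Q (.cons u v) (s + t + 1) :=
  ⟨fun ⟨_, _, h, hQ⟩ => by cases h with | cons h1 h2 => exact ⟨_, _, h1, _, _, h2, hQ⟩,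
    fun ⟨_, _, h1, _, _, h2, hQ⟩ => ⟨_, _, .cons h1 h2, hQ⟩⟩

@[simp]
theorem wp_head {ρ : List Val} {a : Expr} {Q : Val → ℕ → Prop} :
    WP ρ (.head a) Q ↔ WP ρ a fun u s => Q u.head (s + 1) :=
  ⟨fun ⟨_, _, h, hQ⟩ => by cases h with | head h1 => exact ⟨_, _, h1, hQ⟩,
    fun ⟨_, _, h1, hQ⟩ => ⟨_, _, .head h1, hQ⟩⟩

@[simp]
theorem wp_tail {ρ : List Val} {a : Expr} {Q : Val → ℕ → Prop} :
    WP ρ (.tail a) Q ↔ WP ρ a fun u s => Q u.tail (s + 1) :=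
  ⟨fun ⟨_, _, h, hQ⟩ => by cases h with | tail h1 => exact ⟨_, _, h1, hQ⟩,
    fun ⟨_, _, h1, hQ⟩ => ⟨_, _, .tail h1, hQ⟩⟩

@[simp]
theorem wp_ite {ρ : List Val} {c a b : Expr} {Q : Val → ℕ → Prop} :
    WP ρ (.ite c a b) Q ↔ WP ρ c fun u s =>
      if u = .nil then WP ρ b fun v t => Q v (s + t + 1) else WP ρ a fun v t => Q v (s + t + 1) := by
  constructor
  · rintro ⟨_, _, h, hQ⟩
    cases h with
    | ite_cons h1 h2 => exact ⟨_, _, h1, by simpa using ⟨_, _, h2, hQ⟩⟩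
    | ite_nil h1 h2 => exact ⟨_, _, h1, by simpa using ⟨_, _, h2, hQ⟩⟩
  · rintro ⟨u, _, h1, h⟩
    cases u with
    | nil =>
      rw [if_pos rfl] at h
      obtain ⟨_, _, h2, hQ⟩ := h
      exact ⟨_, _, .ite_nil h1 h2, hQ⟩
    | cons x y =>
      rw [if_neg (by simp)] at h
      obtain ⟨_, _, h2, hQ⟩ := h
      exact ⟨_, _, .ite_cons h1 h2, hQ⟩

@[simp]
theorem wp_bind {ρ : List Val} {a b : Expr} {Q : Val → ℕ → Prop} :
    WP ρ (.bind a b) Q ↔ WP ρ a fun u s => WP (u :: ρ) b fun v t => Q v (s + t + 1) :=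
  ⟨fun ⟨_, _, h, hQ⟩ => by cases h with | bind h1 h2 => exact ⟨_, _, h1, _, _, h2, hQ⟩,
    fun ⟨_, _, h1, _, _, h2, hQ⟩ => ⟨_, _, .bind h1 h2, hQ⟩⟩

@[simp]
theorem wp_call {ρ : List Val} {f : ℕ} {a : Expr} {Q : Val → ℕ → Prop} :
    WP ρ (.call f a) Q ↔ WP ρ a fun u s => CallWP f u fun v t => Q v (s + t + 1) :=
  ⟨fun ⟨_, _, h, hQ⟩ => by
      cases h with | call h0 h1 h2 => exact ⟨_, _, h1, _, h0, _, _, h2, hQ⟩,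
    fun ⟨_, _, h1, _, h0, _, _, h2, hQ⟩ => ⟨_, _, .call h0 h1 h2, hQ⟩⟩

theorem Spec.use {f : ℕ} {u v : Val} {T : ℕ} {Q : Val → ℕ → Prop} (h : Spec f u v T)
    (hQ : ∀ t ≤ T, Q v t) : CallWP f u Q := by
  obtain ⟨body, hb, v', t, he, rfl, ht⟩ := h
  exact ⟨body, hb, _, t, he, hQ t ht⟩

theorem Spec.mono {f : ℕ} {u v : Val} {T T' : ℕ} (h : Spec f u v T) (hT : T ≤ T') :
    Spec f u v T' :=
  Spec.use h fun _ ht => ⟨rfl, ht.trans hT⟩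

/-! ### Encodings -/

@[simp] theorem head_nil : Val.nil.head = .nil := rfl

@[simp] theorem tail_nil : Val.nil.tail = .nil := rfl

@[simp] theorem head_cons (a b : Val) : (Val.cons a b).head = a := rfl

@[simp] theorem tail_cons (a b : Val) : (Val.cons a b).tail = b := rfl

@[simp] theorem ofNat_zero : Val.ofNat 0 = .nil := rfl

@[simp] theorem ofNat_succ (m : ℕ) : Val.ofNat (m + 1) = .cons .nil (.ofNat m) := rfl

@[simp]
theorem ofNat_eq_nil {m : ℕ} : Val.ofNat m = .nil ↔ m = 0 := by cases m <;> simp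

@[simp]
theorem tail_ofNat (m : ℕ) : (Val.ofNat m).tail = .ofNat (m - 1) := by cases m <;> rfl

/-- Lists of numbers. -/
def encList (l : List ℕ) : Val := .ofList (l.map .ofNat)

@[simp] theorem encList_nil : encList [] = .nil := rfl

@[simp]
theorem encList_cons (d : ℕ) (l : List ℕ) : encList (d :: l) = .cons (.ofNat d) (encList l) := rfl

/-- The list `l` without its first `d` elements. -/
def dropVal : ℕ → Val → Val
  | 0, l => l
  | d + 1, l => dropVal d l.tail

theorem dropVal_encList (d : ℕ) (l : List ℕ) : dropVal d (encList l) = encList (l.drop d) := by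
  induction d generalizing l with
  | zero => rfl
  | succ d ih =>
    cases l with
    | nil => exact (ih []).trans (by simp)
    | cons a l => exact ih l

@[simp]
theorem head_encList (l : List ℕ) : (encList l).head = .ofNat (l.getD 0 0) := by
  cases l <;> rfl

-- Routines on numerals, lists and states

theorem spec_drop (d : ℕ) (l : Val) :
    Spec 0 (.cons l (.ofNat d)) (dropVal d l) (12 * (d + 1)) := by
  induction d generalizing l with
  | zero =>
    refine ⟨_, rfl, ?_⟩
    simp [dropBody, dropVal]
  | succ d ih =>
    refine ⟨_, rfl, ?_⟩
    simp [dropBody, dropVal]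
    refine (ih l.tail).use fun t ht => ⟨rfl, ?_⟩
    omega

@[simp] theorem ofBool_eq_nil {b : Bool} : Val.ofBool b = .nil ↔ b = false := by
  cases b <;> simp [Val.ofBool]

theorem spec_set (i x : ℕ) (l : List ℕ) (hi : i < l.length) :
    Spec 1 (.cons (encList l) (.cons (.ofNat i) (.ofNat x))) (encList (l.set i x))
      (30 * (i + 1)) := by
  induction i generalizing l with
  | zero =>
    refine ⟨_, rfl, ?_⟩
    cases l with
    | nil => simp at hi
    | cons a l => simp [setBody]
  | succ i ih =>
    refine ⟨_, rfl, ?_⟩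
    cases l with
    | nil => simp at hi
    | cons a l =>
      simp [setBody]
      refine (ih l (by simpa using hi)).use fun t ht => ⟨rfl, ?_⟩
      omega

theorem spec_eq (x y : ℕ) :
    Spec 2 (.cons (.ofNat x) (.ofNat y)) (.ofBool (decide (x = y))) (20 * (x + 1)) := by
  induction x generalizing y with
  | zero =>
    refine ⟨_, rfl, ?_⟩
    cases y <;> simp [eqBody, Val.ofBool]
  | succ x ih =>
    refine ⟨_, rfl, ?_⟩
    cases y with
    | zero => simp [eqBody, Val.ofBool]; omega
    | succ y =>
      simp [eqBody]
      refine (ih y).use fun t ht => ⟨rfl, ?_⟩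
      omega

theorem spec_mem (x : ℕ) (l : List ℕ) :
    Spec 3 (.cons (.ofNat x) (encList l)) (.ofBool (decide (x ∈ l)))
      ((l.length + 1) * (20 * (x + 1) + 30)) := by
  induction l with
  | nil => exact ⟨_, rfl, by simp [memBody, Val.ofBool]⟩
  | cons a l ih =>
    refine ⟨_, rfl, ?_⟩
    simp [memBody]
    refine (spec_eq x a).use fun t ht => ?_
    by_cases h : x = a
    · simp [h, Val.ofBool]
      subst h
      nlinarith
    · simp [h]
      refine ih.use fun t' ht' => ⟨rfl, ?_⟩
      linarith

/-- The entry of the table `t` for the state `st`. -/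
def lookupVal : Val → List ℕ → Val
  | t, [] => t
  | t, d :: st => lookupVal (dropVal d t).head st

theorem spec_lookup (B : ℕ) (st : List ℕ) (hB : ∀ d ∈ st, d ≤ B) (t : Val) :
    Spec 4 (.cons t (encList st)) (lookupVal t st) ((st.length + 1) * (12 * (B + 1) + 30)) := by
  induction st generalizing t with
  | nil => exact ⟨_, rfl, by simp [lookupBody, lookupVal]⟩
  | cons d st ih =>
    refine ⟨_, rfl, ?_⟩
    simp [lookupBody]
    refine (spec_drop d t).use fun t1 ht1 => ?_
    refine (ih (fun d hd => hB d (by simp [hd])) _).use fun t2 ht2 => ⟨rfl, ?_⟩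
    have := hB d (by simp)
    linarith

theorem spec_le (x y : ℕ) :
    Spec 5 (.cons (.ofNat x) (.ofNat y)) (.ofBool (decide (x ≤ y))) (20 * (x + 1)) := by
  induction x generalizing y with
  | zero => exact ⟨_, rfl, by simp [leBody, Val.ofBool]⟩
  | succ x ih =>
    refine ⟨_, rfl, ?_⟩
    cases y with
    | zero => simp [leBody, Val.ofBool]; omega
    | succ y =>
      simp [leBody]
      refine (ih y).use fun t ht => ⟨rfl, ?_⟩
      omega

theorem spec_min (x y : ℕ) :
    Spec 6 (.cons (.ofNat x) (.ofNat y)) (.ofNat (minCost x y)) (20 * (x + 2)) := by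
  refine ⟨_, rfl, ?_⟩
  unfold minCost
  by_cases hx : x = 0
  · simp [minBody, hx]
  by_cases hy : y = 0
  · simp [minBody, hx, hy]; omega
  simp [minBody, hx, hy]
  refine (spec_le x y).use fun t ht => ?_
  by_cases h : x ≤ y
  · simp [h]; omega
  · simp [h]; omega

theorem spec_plus (x y : ℕ) :
    Spec 7 (.cons (.ofNat x) (.ofNat y)) (.ofNat (x + y)) (20 * (x + 1)) := by
  induction x with
  | zero => exact ⟨_, rfl, by simp [plusBody]⟩
  | succ x ih =>
    refine ⟨_, rfl, ?_⟩
    simp [plusBody]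
    refine ih.use fun t ht => ⟨by rw [Nat.add_right_comm]; rfl, ?_⟩
    omega

theorem spec_add (x y : ℕ) :
    Spec 8 (.cons (.ofNat x) (.ofNat y)) (.ofNat (addCost x y)) (20 * (x + 1)) := by
  refine ⟨_, rfl, ?_⟩
  unfold addCost
  by_cases hx : x = 0
  · simp [addBody, hx]
  by_cases hy : y = 0
  · simp [addBody, hx, hy]; omega
  simp [addBody, hx, hy]
  refine (spec_plus (x - 1) y).use fun t ht => ⟨rfl, ?_⟩
  omega

theorem spec_compat (d r : ℕ) :
    Spec 11 (.cons (.ofNat d) (.ofNat r)) (.ofBool (decide (Compat d r))) (20 * (d + 2)) := by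
  refine ⟨_, rfl, ?_⟩
  unfold Compat
  by_cases hd : d = 0
  · simp [compatBody, hd, Val.ofBool]
  simp [compatBody, hd]
  refine (spec_eq d r).use fun t ht => ⟨rfl, ?_⟩
  omega

theorem spec_recolour (st : List ℕ) (i j r : ℕ) (hi : i < st.length) (hj : j < st.length)
    (hr : r < st.length) :
    Spec 12 (.cons (encList st) (.cons (.ofNat i) (.cons (.ofNat j) (.ofNat r))))
      (encList (recolour st i j r)) (500 * (st.length + 1) ^ 2) := by
  refine ⟨_, rfl, ?_⟩
  unfold recolour
  simp [recolourBody]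
  refine (spec_mem r st).use fun t ht => ?_
  have h1 : (st.length + 1) * (20 * (r + 1) + 30) ≤ 50 * (st.length + 1) ^ 2 := by nlinarith
  by_cases h : r ∈ st
  · simp [h]
    refine (spec_set i r st hi).use fun t2 ht2 => ?_
    refine (spec_set j r _ (by simpa using hj)).use fun t3 ht3 => ⟨rfl, ?_⟩
    nlinarith
  · simp [h]
    refine (spec_set r 1 st hr).use fun t1 ht1 => ?_
    refine (spec_set i r _ (by simpa using hi)).use fun t2 ht2 => ?_
    refine (spec_set j r _ (by simpa using hj)).use fun t3 ht3 => ⟨rfl, ?_⟩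
    nlinarith

theorem spec_rev (l acc : List ℕ) :
    Spec 14 (.cons (encList l) (encList acc)) (encList (l.reverse ++ acc))
      (20 * (l.length + 1)) := by
  induction l generalizing acc with
  | nil => exact ⟨_, rfl, by simp [revBody]⟩
  | cons a l ih =>
    refine ⟨_, rfl, ?_⟩
    simp [revBody]
    refine (ih (a :: acc)).use fun t ht => ⟨rfl, ?_⟩
    omega

theorem spec_max (x y : ℕ) :
    Spec 18 (.cons (.ofNat x) (.ofNat y)) (.ofNat (max x y)) (20 * (x + 1)) := by
  induction x generalizing y with
  | zero => exact ⟨_, rfl, by simp [maxBody]⟩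
  | succ x ih =>
    refine ⟨_, rfl, ?_⟩
    cases y with
    | zero => simp [maxBody]; omega
    | succ y =>
      simp [maxBody]
      refine (ih y).use fun t ht => ⟨rfl, ?_⟩
      omega

theorem spec_rep (m x : ℕ) (acc : List ℕ) :
    Spec 20 (.cons (.ofNat m) (.cons (.ofNat x) (encList acc)))
      (encList (List.replicate m x ++ acc)) (20 * (m + 1)) := by
  induction m with
  | zero => exact ⟨_, rfl, by simp [repBody]⟩
  | succ m ih =>
    refine ⟨_, rfl, ?_⟩
    simp [repBody]
    refine ih.use fun t ht => ⟨rfl, ?_⟩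
    omega

/-- Yields `W ≤ w + 2` for the `W` that the program computes. -/
theorem maxLabel_lt {n w : ℕ} (Φ : WExpr (Fin n) w) : maxLabel Φ < w := by
  induction Φ with
  | intro i v => exact i.2
  | union a b iha ihb => exact max_lt iha ihb
  | rename i j a ih | join i j a ih => exact max_lt i.2 (max_lt j.2 ih)

theorem spec_maxLabel {n w : ℕ} (Φ : WExpr (Fin n) w) :
    Spec 19 Φ.encode (.ofNat (maxLabel Φ)) (Φ.size * (40 * (w + 2))) := by
  induction Φ with
  | intro i v =>
    refine ⟨_, rfl, ?_⟩
    simp [maxLabelBody, WExpr.encode, maxLabel, WExpr.size]; omega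
  | union a b iha ihb =>
    refine ⟨_, rfl, ?_⟩
    simp [maxLabelBody, WExpr.encode, maxLabel]
    refine iha.use fun t ht => ihb.use fun t1 ht1 => (spec_max _ _).use fun t2 ht2 => ⟨rfl, ?_⟩
    have := maxLabel_lt a
    simp only [WExpr.size]
    nlinarith
  | rename i j a ih | join i j a ih =>
    refine ⟨_, rfl, ?_⟩
    simp [maxLabelBody, WExpr.encode, maxLabel]
    refine ih.use fun t ht => (spec_max _ _).use fun t1 ht1 => (spec_max _ _).use
      fun t2 ht2 => ⟨rfl, ?_⟩
    have := i.2
    have := j.2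
    simp only [WExpr.size]
    nlinarith

/-! ### Bounds on states and costs -/

/-- The bounds for the digits of a state. -/
def bases (W : ℕ) : List ℕ := List.replicate W (2 * W) ++ List.replicate W 2

/-- All digits of `st` are below the bounds `bs`. -/
abbrev InRange (st bs : List ℕ) : Prop := List.Forall₂ (· < ·) st bs

theorem InRange.lt {st bs : List ℕ} (h : InRange st bs) {B : ℕ} (hB : ∀ b ∈ bs, b ≤ B) :
    ∀ d ∈ st, d < B := by
  induction h with
  | nil => simp
  | cons hd _ ih =>
    simp only [List.mem_cons, forall_eq_or_imp] at hB ⊢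
    exact ⟨hd.trans_le hB.1, ih hB.2⟩

theorem InRange.set {st bs : List ℕ} (h : InRange st bs) {i x : ℕ}
    (hx : ∀ b, bs[i]? = some b → x < b) : InRange (st.set i x) bs := by
  induction h generalizing i with
  | nil => simp
  | cons hd h ih =>
    cases i with
    | zero => exact .cons (hx _ rfl) h
    | succ i => exact .cons hd (ih hx)

theorem bases_length (W : ℕ) : (bases W).length = 2 * W := by simp [bases]; omega

theorem bases_le {W : ℕ} (hW : 1 ≤ W) : ∀ b ∈ bases W, b ≤ 2 * W := by
  simp only [bases, List.mem_append, List.mem_replicate]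
  omega

theorem bases_get {W i b : ℕ} (h : (bases W)[i]? = some b) :
    (i < W → b = 2 * W) ∧ (W ≤ i → b = 2) := by
  simp only [bases, List.getElem?_append, List.length_replicate, List.getElem?_replicate] at h
  split_ifs at h <;> simp at h <;> omega

theorem InRange.set_label {W : ℕ} {st : List ℕ} (h : InRange st (bases W)) {i x : ℕ} (hi : i < W)
    (hx : x < 2 * W) : InRange (st.set i x) (bases W) :=
  h.set fun b hb => by have := (bases_get hb).1 hi; omega

theorem InRange.recolour {W : ℕ} {st : List ℕ} (h : InRange st (bases W)) {i j r : ℕ} (hi : i < W)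
    (hj : j < W) (hW : 1 ≤ W) (hr : r < 2 * W) : InRange (recolour st i j r) (bases W) := by
  unfold MultiwayCut.recolour
  refine (InRange.set_label ?_ hi hr).set_label hj hr
  split_ifs
  · exact h
  · exact h.set fun b hb => by
      have := bases_get hb
      by_cases r < W <;> omega

theorem InRange.getD_lt {W : ℕ} {st : List ℕ} (h : InRange st (bases W)) (hW : 1 ≤ W) (j : ℕ) :
    st.getD j 0 < 2 * W := by
  by_cases hj : j < st.length
  · rw [List.getD_eq_getElem _ _ hj]
    exact h.lt (bases_le hW) _ (List.getElem_mem hj)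
  · rw [List.getD_eq_default _ _ (by omega)]
    omega

theorem minCost_le {a b B : ℕ} (ha : a ≤ B) (hb : b ≤ B) : minCost a b ≤ B := by
  unfold minCost
  split_ifs <;> assumption

theorem splitCost_le {a b : ℕ} (st : List ℕ) (f g : List ℕ → ℕ) (hf : ∀ s, f s ≤ a + 1)
    (hg : ∀ s, g s ≤ b + 1) : splitCost st f g ≤ a + b + 1 := by
  induction st generalizing f g with
  | nil =>
    have := hf []
    have := hg []
    unfold splitCost addCost
    split_ifs <;> omega
  | cons d st ih =>
    unfold splitCost
    split_ifs
    · exact minCost_le (ih _ _ (fun s => hf _) fun s => hg _) (ih _ _ (fun s => hf _) fun s => hg _)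
    · exact ih _ _ (fun s => hf _) fun s => hg _

theorem joinCost_le {B : ℕ} (f : List ℕ → ℕ) (hf : ∀ s, f s ≤ B) (st : List ℕ) (i j m r : ℕ) :
    joinCost f st i j m r ≤ B := by
  induction m generalizing r with
  | zero => exact Nat.zero_le _
  | succ m ih =>
    unfold joinCost
    refine minCost_le ?_ (ih _)
    split_ifs
    · exact hf _
    · exact Nat.zero_le _
    · exact Nat.zero_le _

/-- Costs are unary numerals, so the time for sums and minima depends on their size. The bound holds
for all lists, well-formed or not, as the tables contain both; disjointness of unions makes it
additive. -/
theorem cost_le {n w : ℕ} (W : ℕ) (T : Finset (Fin n)) (Φ : WExpr (Fin n) w) (hΦ : Φ.Valid)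
    (st : List ℕ) : cost W T Φ st ≤ Φ.verts.card + 1 := by
  induction Φ generalizing st with
  | intro i v =>
    unfold cost introCost
    simp only [WExpr.verts, Finset.card_singleton]
    split_ifs <;> omega
  | union a b iha ihb =>
    simp only [WExpr.verts]
    rw [Finset.card_union_of_disjoint hΦ.2.2]
    exact splitCost_le _ _ _ (iha hΦ.1) (ihb hΦ.2.1)
  | rename i j a ih => exact ih hΦ _
  | join i j a ih => exact minCost_le (ih hΦ _) (minCost_le (ih hΦ _) (joinCost_le _ (ih hΦ) _ _ _ _ _))

/-! ### Entries of the tables -/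

/-- The factor `2 ^ (st.length + 1) - 1` is the size of a complete binary recursion tree, as if
every digit branched. Both tables are descended along with the digits, so no full lookup is needed
at the leaves. -/
theorem spec_split {B : ℕ} (st bs : List ℕ) (X Y : Val) (f g : List ℕ → ℕ) (h : InRange st bs)
    (hB : ∀ b ∈ bs, b ≤ B) (hX : ∀ s, InRange s bs → lookupVal X s = .ofNat (f s))
    (hY : ∀ s, InRange s bs → lookupVal Y s = .ofNat (g s)) (hf : ∀ s, f s ≤ B + 1)
    (hg : ∀ s, g s ≤ B + 1) :
    Spec 9 (.cons (.cons X Y) (encList st)) (.ofNat (splitCost st f g))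
      (200 * (B + 1) * (2 ^ (st.length + 1) - 1)) := by
  induction h generalizing X Y f g with
  | nil =>
    refine ⟨_, rfl, ?_⟩
    have h1 := hX [] .nil
    have h2 := hY [] .nil
    simp only [lookupVal] at h1 h2
    subst h1 h2
    simp [splitBody]
    refine (spec_add _ _).use fun t ht => ⟨rfl, ?_⟩
    have := hf []
    omega
  | @cons d b st bs hd h ih =>
    simp only [List.mem_cons, forall_eq_or_imp] at hB
    have hp : 2 ^ ((d :: st).length + 1) - 1 = 2 * (2 ^ (st.length + 1) - 1) + 1 := by
      have : 0 < 2 ^ (st.length + 1) := by positivity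
      simp only [List.length_cons]
      rw [pow_succ 2 (st.length + 1)]
      omega
    rw [hp]
    generalize 2 ^ (st.length + 1) - 1 = p at ih
    have key : ∀ e, e < b → ∀ (Z : Val) (k : List ℕ → ℕ),
        (∀ s, InRange s (b :: bs) → lookupVal Z s = .ofNat (k s)) →
        ∀ s, InRange s bs → lookupVal (dropVal e Z).head s = .ofNat (k (e :: s)) :=
      fun e he Z k hZ s hs => hZ (e :: s) (.cons he hs)
    refine ⟨_, rfl, ?_⟩
    simp [splitBody]
    refine (spec_eq d 1).use fun t ht => ?_
    unfold splitCost
    by_cases h1 : d = 1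
    · subst h1
      simp
      refine (ih X.tail.head Y.head _ _ hB.2 (key 1 hd X f hX) (key 0 (by omega) Y g hY)
        (fun _ => hf _) fun _ => hg _).use fun t1 ht1 => ?_
      refine (ih X.head Y.tail.head _ _ hB.2 (key 0 (by omega) X f hX) (key 1 hd Y g hY)
        (fun _ => hf _) fun _ => hg _).use fun t2 ht2 => ?_
      refine (spec_min _ _).use fun t3 ht3 => ⟨rfl, ?_⟩
      have := splitCost_le st (fun l => f (1 :: l)) (fun l => g (0 :: l)) (fun _ => hf _)
        fun _ => hg _
      nlinarith
    · simp [h1]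
      refine (spec_drop _ _).use fun t1 ht1 => (spec_drop _ _).use fun t2 ht2 => ?_
      refine (ih _ _ _ _ hB.2 (key d hd X f hX) (key d hd Y g hY) (fun _ => hf _)
        fun _ => hg _).use fun t3 ht3 => ⟨rfl, ?_⟩
      have : d ≤ B := hd.le.trans hB.1
      nlinarith

theorem spec_joinLoop {B i j : ℕ} (X : Val) (st l : List ℕ) (f : List ℕ → ℕ) (r : ℕ)
    (hlen : st.length ≤ B) (hd : ∀ d ∈ st, d ≤ B) (hi : i < st.length) (hj : j < st.length)
    (hr : r + l.length ≤ st.length) (hf : ∀ s, f s ≤ B + 1)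
    (hX : ∀ q, r ≤ q → q < r + l.length →
      lookupVal X (recolour st i j q) = .ofNat (f (recolour st i j q))) :
    Spec 10 (.cons (.cons X (.cons (encList st) (.cons (.ofNat i) (.ofNat j))))
      (.cons (encList l) (.ofNat r))) (.ofNat (joinCost f st i j l.length r))
      ((l.length + 1) * (1000 * (B + 1) ^ 2)) := by
  induction l generalizing r with
  | nil =>
    refine ⟨_, rfl, ?_⟩
    simp [joinBody, joinCost]
    nlinarith
  | cons a l ih =>
    simp only [List.length_cons] at hr hX
    have hget : ∀ x, st.getD x 0 ≤ B := fun x => by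
      by_cases hx : x < st.length
      · rw [List.getD_eq_getElem _ _ hx]
        exact hd _ (List.getElem_mem hx)
      · rw [List.getD_eq_default _ _ (by omega)]
        omega
    have hih := ih (r + 1) (by omega) fun q h1 h2 => hX q (by omega) (by omega)
    have hrec : ∀ d ∈ recolour st i j r, d ≤ B := by
      intro d hdm
      unfold recolour at hdm
      rcases List.mem_or_eq_of_mem_set hdm with h | h
      · rcases List.mem_or_eq_of_mem_set h with h | h
        · split_ifs at h
          · exact hd d h
          · rcases List.mem_or_eq_of_mem_set h with h | h
            · exact hd d h
            · omega
        · omega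
      · omega
    have hreclen : (recolour st i j r).length = st.length := by
      unfold recolour
      split_ifs <;> simp
    refine ⟨_, rfl, ?_⟩
    simp [joinBody, joinCost]
    have e1 : 12 * (i + 1) ≤ 12 * (B + 1) := by omega
    have e2 : 12 * (j + 1) ≤ 12 * (B + 1) := by omega
    have e3 := hget i
    have e4 := hget j
    have hsq : 500 * (st.length + 1) ^ 2 ≤ 500 * (B + 1) ^ 2 := by gcongr
    have hsq2 : (st.length + 1) * (12 * (B + 1) + 30) ≤ 12 * (B + 1) ^ 2 + 30 * (B + 1) :=
      (Nat.mul_le_mul_right _ (by omega : st.length + 1 ≤ B + 1)).trans (by nlinarith)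
    have hsq3 : B + 1 ≤ (B + 1) ^ 2 := by nlinarith
    have hgoal : (l.length + 1 + 1) * (1000 * (B + 1) ^ 2) =
      (l.length + 1) * (1000 * (B + 1) ^ 2) + 1000 * (B + 1) ^ 2 := by ring
    rw [hgoal]
    generalize (l.length + 1) * (1000 * (B + 1) ^ 2) = u at hih
    -- With the products as atoms, the remaining time estimates are linear.
    generalize (B + 1) ^ 2 = z at *
    have hget' : ∀ x, st.getD x 0 = st[x]?.getD 0 := fun x => List.getD_eq_getElem?_getD
    rw [hget'] at e3 e4
    refine (spec_drop i _).use fun t1 ht1 => ?_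
    simp [dropVal_encList]
    refine (spec_compat _ _).use fun t2 ht2 => ?_
    by_cases h1 : Compat (st[i]?.getD 0) r
    · simp [h1]
      refine (spec_drop j _).use fun t3 ht3 => ?_
      simp [dropVal_encList]
      refine (spec_compat _ _).use fun t4 ht4 => ?_
      by_cases h2 : Compat (st[j]?.getD 0) r
      · simp [h2]
        refine (spec_recolour st i j r hi hj (by omega)).use fun t5 ht5 => ?_
        refine (spec_lookup B _ hrec _).use fun t6 ht6 => ?_
        refine hih.use fun t7 ht7 => ?_
        rw [hX r le_rfl (by omega)]
        refine (spec_min _ _).use fun t8 ht8 => ⟨rfl, ?_⟩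
        have := hf (recolour st i j r)
        rw [hreclen] at ht6
        omega
      · simp [h2]
        refine hih.use fun t7 ht7 => (spec_min 0 _).use fun t8 ht8 => ⟨rfl, ?_⟩
        omega
    · simp [h1]
      refine hih.use fun t7 ht7 => (spec_min 0 _).use fun t8 ht8 => ⟨rfl, ?_⟩
      omega

theorem spec_intro {B i v : ℕ} (Tl st : List ℕ) (term : Prop) [Decidable term]
    (hterm : term ↔ v ∈ Tl) (hT : Tl.length ≤ B) (hi : i ≤ B) (hv : v ≤ B)
    (hd : ∀ d ∈ st, d ≤ B) :
    Spec 15 (.cons (.cons (encList Tl) (.cons (.ofNat i) (.ofNat v))) (encList st))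
      (.ofNat (introCost term st i)) (1000 * (B + 1) ^ 2) := by
  have hg : st[i]?.getD 0 ≤ B := by
    by_cases hx : i < st.length
    · rw [List.getElem?_eq_getElem hx]
      exact hd _ (List.getElem_mem hx)
    · rw [List.getElem?_eq_none (by omega)]
      exact Nat.zero_le _
  have hm : (Tl.length + 1) * (20 * (v + 1) + 30) ≤ 20 * (B + 1) ^ 2 + 30 * (B + 1) :=
    (Nat.mul_le_mul (by omega : _ ≤ B + 1) (by omega : _ ≤ 20 * (B + 1) + 30)).trans
      (by nlinarith)
  have hsq : B + 1 ≤ (B + 1) ^ 2 := by nlinarith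
  generalize (B + 1) ^ 2 = z at *
  refine ⟨_, rfl, ?_⟩
  simp [introBody]
  refine (spec_drop i _).use fun t1 ht1 => ?_
  simp [dropVal_encList]
  refine (spec_mem v Tl).use fun t2 ht2 => ?_
  unfold introCost
  simp only [hterm, List.getD_eq_getElem?_getD]
  generalize st[i]?.getD 0 = d at *
  by_cases hv : v ∈ Tl
  · simp [hv]
    by_cases h0 : d = 0
    · simp [h0]; omega
    by_cases h2 : d ≤ 2
    -- The program tests `d ≤ 2` by taking two tails of the numeral.
    · have : d - 1 - 1 = 0 := by omega
      simp [h0, h2, this]; omega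
    · have h3 : ¬ d - 1 - 1 = 0 := by omega
      simp [h0, h2, h3]
      refine (spec_drop d _).use fun t3 ht3 => ?_
      by_cases h4 : st[d]?.getD 0 = 0
      · simp [dropVal_encList, h4]; omega
      · simp [dropVal_encList, h4]; omega
  · simp [hv]
    by_cases h0 : d = 0
    · simp [h0]; omega
    by_cases h2 : d ≤ 2
    · have : d - 1 - 1 = 0 := by omega
      simp [h0, h2, this]; omega
    · have h3 : ¬ d - 1 - 1 = 0 := by omega
      simp [h0, h2, h3]; omega

/-! ### Tables -/

/-- The list of the values of `g` at `d, …, d + m - 1`. -/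
def rowVal (g : ℕ → Val) : ℕ → ℕ → Val
  | 0, _ => .nil
  | m + 1, d => .cons (g d) (rowVal g m (d + 1))

/-- The table of the values of `f` at the states that start with the reverse of `pre` and go on with
digits bounded by `bs`. -/
def tableVal (f : List ℕ → Val) : List ℕ → List ℕ → Val
  | [], pre => f pre.reverse
  | b :: bs, pre => rowVal (fun d => tableVal f bs (d :: pre)) b 0

theorem head_dropVal_rowVal (g : ℕ → Val) {e m : ℕ} (d : ℕ) (h : e < m) :
    (dropVal e (rowVal g m d)).head = g (d + e) := by
  induction e generalizing m d with
  | zero =>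
    obtain ⟨m, rfl⟩ : ∃ k, m = k + 1 := ⟨m - 1, by omega⟩
    rfl
  | succ e ih =>
    obtain ⟨m, rfl⟩ : ∃ k, m = k + 1 := ⟨m - 1, by omega⟩
    have := ih (m := m) (d + 1) (by omega)
    rw [show d + (e + 1) = d + 1 + e by ring, ← this]
    rfl

theorem lookupVal_tableVal (f : List ℕ → Val) {s bs : List ℕ} (h : InRange s bs) (pre : List ℕ) :
    lookupVal (tableVal f bs pre) s = f (pre.reverse ++ s) := by
  induction h generalizing pre with
  | nil => simp [lookupVal, tableVal]
  | cons hd _ ih =>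
    simp only [lookupVal, tableVal]
    rw [head_dropVal_rowVal _ _ hd, ih]
    simp

/-- Time to build a table. -/
def buildTime (L : ℕ) : List ℕ → ℕ
  | [] => L
  | b :: bs => b * (buildTime L bs + 60) + 60

theorem spec_build {L B : ℕ} {ctx : Val} {f : List ℕ → Val} (bs pre : List ℕ)
    (hB : pre.length + bs.length ≤ B)
    (hf : ∀ s, InRange s bs →
      Spec 13 (.cons ctx (encList (pre.reverse ++ s))) (f (pre.reverse ++ s)) L) :
    Spec 16 (.cons ctx (.cons (encList bs) (.cons .nil (encList pre)))) (tableVal f bs pre)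
      (buildTime (L + 20 * (B + 2)) bs) := by
  induction bs generalizing pre with
  | nil =>
    refine ⟨_, rfl, ?_⟩
    simp [buildBody, tableVal, buildTime]
    have h1 := spec_rev pre []
    have h2 := hf [] .nil
    simp only [List.append_nil, encList_nil] at h1 h2
    refine h1.use fun t ht => h2.use fun t1 ht1 => ⟨rfl, ?_⟩
    simp at hB
    omega
  | cons b bs ih =>
    -- A row is built with `m` digits left and `d` the next one; `m` counts down while `d` counts
    -- up.
    have key : ∀ m d, d + m ≤ b →
        Spec 16 (.cons ctx (.cons (.cons (.ofNat m) (encList bs)) (.cons (.ofNat d) (encList pre))))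
          (rowVal (fun d => tableVal f bs (d :: pre)) m d)
          (m * (buildTime (L + 20 * (B + 2)) bs + 60) + 60) := by
      intro m
      induction m with
      | zero =>
        intro d _
        refine ⟨_, rfl, ?_⟩
        simp [buildBody, rowVal]
      | succ m ihm =>
        intro d hd
        refine ⟨_, rfl, ?_⟩
        simp [buildBody, rowVal]
        refine Spec.use (ih (d :: pre) (by simp at hB ⊢; omega) ?_) fun t ht => ?_
        · intro s hs
          have := hf (d :: s) (.cons (by omega) hs)
          simpa using this
        · refine (ihm (d + 1) (by omega)).use fun t1 ht1 => ⟨⟨rfl, rfl⟩, ?_⟩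
          rw [add_mul, one_mul]
          omega
    exact key b 0 (by omega)

/-- Carrying `+ 60` on the left and using `b + 2` instead of `b` absorbs the additive overheads, so
the bound is a pure product. -/
theorem buildTime_le (L : ℕ) (bs : List ℕ) :
    buildTime L bs + 60 ≤ (L + 60) * (bs.map (· + 2)).prod := by
  induction bs with
  | nil => simp [buildTime]
  | cons b bs ih =>
    simp only [buildTime, List.map_cons, List.prod_cons]
    calc b * (buildTime L bs + 60) + 60 + 60 ≤ (b + 2) * (buildTime L bs + 60) := by
          rw [add_mul]; omega
      _ ≤ (b + 2) * ((L + 60) * (bs.map (· + 2)).prod) := Nat.mul_le_mul_left _ ih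
      _ = _ := by ring

theorem buildTime_bases_le (L W : ℕ) :
    buildTime L (bases W) + 60 ≤ (L + 60) * (8 * (W + 1)) ^ W := by
  refine (buildTime_le _ _).trans_eq ?_
  simp only [bases, List.map_append, List.map_replicate, List.prod_append, List.prod_replicate]
  rw [← mul_pow]
  congr 2
  ring

/-- The table `X` lists the values of `f`. -/
def IsTable (W : ℕ) (X : Val) (f : List ℕ → ℕ) : Prop :=
  ∀ s, InRange s (bases W) → lookupVal X s = .ofNat (f s)

theorem spec_lookup_table {B W : ℕ} {X : Val} {f : List ℕ → ℕ} (hX : IsTable W X f) {s : List ℕ}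
    (hs : InRange s (bases W)) (hW : 1 ≤ W) (hB : 2 * W ≤ B) :
    Spec 4 (.cons X (encList s)) (.ofNat (f s)) (50 * (B + 1) ^ 2) := by
  rw [← hX s hs]
  refine (spec_lookup B s (fun d hd => ?_) X).mono ?_
  · have := hs.lt (bases_le hW) d hd
    omega
  · have : s.length ≤ B := by
      rw [hs.length_eq, bases_length]
      exact hB
    nlinarith

theorem spec_rename {B W i j : ℕ} {X : Val} {f : List ℕ → ℕ} (hX : IsTable W X f) {st : List ℕ}
    (hs : InRange st (bases W)) (hi : i < W) (hj : j < W) (hB : 2 * W ≤ B) :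
    Spec 21 (.cons (.cons (.ofNat i) (.cons (.ofNat j) X)) (encList st))
      (.ofNat (f (st.set i (st.getD j 0)))) (200 * (B + 1) ^ 2) := by
  have hlen : st.length = 2 * W := by rw [hs.length_eq, bases_length]
  have hlt := hs.getD_lt (by omega) j
  have hsq : B + 1 ≤ (B + 1) ^ 2 := by nlinarith
  refine ⟨_, rfl, ?_⟩
  simp [renameBody]
  refine (spec_drop j _).use fun t1 ht1 => ?_
  simp only [List.getD_eq_getElem?_getD] at hlt ⊢
  simp [dropVal_encList]
  refine (spec_set i _ st (by omega)).use fun t2 ht2 => ?_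
  refine (spec_lookup_table hX (hs.set_label hi hlt) (by omega) hB).use
    fun t3 ht3 => ⟨rfl, ?_⟩
  omega

theorem spec_joinAll {B W i j : ℕ} {X : Val} {f : List ℕ → ℕ} (hX : IsTable W X f) {st : List ℕ}
    (hf : ∀ s, f s ≤ B + 1) (hs : InRange st (bases W)) (hi : i < W) (hj : j < W) (hW : 3 ≤ W)
    (hB : 2 * W ≤ B) :
    Spec 22 (.cons (.cons (.ofNat W) (.cons (.ofNat i) (.cons (.ofNat j) X))) (encList st))
      (.ofNat (minCost (f (st.set i 2)) (minCost (f (st.set j 2)) (joinCost f st i j W W))))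
      (3000 * (B + 1) ^ 3) := by
  have hlen : st.length = 2 * W := by rw [hs.length_eq, bases_length]
  -- The marks at the end of the state serve as the loop counter for the `W` colours; only their
  -- number matters.
  have hdl : (st.drop W).length = W := by rw [List.length_drop]; omega
  have hsq : B + 1 ≤ (B + 1) ^ 2 := by nlinarith
  have hcu : (B + 1) ^ 2 ≤ (B + 1) ^ 3 := Nat.pow_le_pow_right (by omega) (by omega)
  have hmul : (W + 1) * (1000 * (B + 1) ^ 2) ≤ 1000 * (B + 1) ^ 3 := by
    calc (W + 1) * (1000 * (B + 1) ^ 2) ≤ (B + 1) * (1000 * (B + 1) ^ 2) := by gcongr; omega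
      _ = _ := by ring
  refine ⟨_, rfl, ?_⟩
  simp [joinAllBody]
  refine (spec_set i 2 st (by omega)).use fun t1 ht1 => ?_
  refine (spec_lookup_table hX (hs.set_label hi (by omega)) (by omega) hB).use fun t2 ht2 => ?_
  refine (spec_set j 2 st (by omega)).use fun t3 ht3 => ?_
  refine (spec_lookup_table hX (hs.set_label hj (by omega)) (by omega) hB).use fun t4 ht4 => ?_
  refine (spec_drop W _).use fun t5 ht5 => ?_
  rw [dropVal_encList]
  have h10 := spec_joinLoop (B := B) (i := i) (j := j) X st (st.drop W) f W (by omega)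
    (fun d hd => by have := hs.lt (bases_le (by omega)) d hd; omega) (by omega) (by omega)
    (by omega) hf (fun q h1 h2 => hX _ (hs.recolour hi hj (by omega) (by omega)))
  rw [hdl] at h10
  refine h10.use fun t6 ht6 => (spec_min _ _).use fun t7 ht7 => (spec_min _ _).use
    fun t8 ht8 => ⟨rfl, ?_⟩
  have := hf (st.set i 2)
  have := hf (st.set j 2)
  omega

/-- The table of an expression. -/
def table {n w : ℕ} (W : ℕ) (T : Finset (Fin n)) (Φ : WExpr (Fin n) w) : Val :=
  tableVal (fun s => .ofNat (cost W T Φ s)) (bases W) []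

theorem isTable_table {n w : ℕ} (W : ℕ) (T : Finset (Fin n)) (Φ : WExpr (Fin n) w) :
    IsTable W (table W T Φ) (cost W T Φ) := fun s hs => by
  unfold table
  rw [lookupVal_tableVal _ hs]
  rfl

/-- The outermost operation of an expression, with tables for its operands. -/
def node {n w : ℕ} (W : ℕ) (T : Finset (Fin n)) : WExpr (Fin n) w → Val
  | .intro i v => .cons (.ofNat 0) (.cons (.ofNat i) (.ofNat v))
  | .union a b => .cons (.ofNat 1) (.cons (table W T a) (table W T b))
  | .rename i j a => .cons (.ofNat 2) (.cons (.ofNat i) (.cons (.ofNat j) (table W T a)))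
  | .join i j a => .cons (.ofNat 3) (.cons (.ofNat i) (.cons (.ofNat j) (table W T a)))

/-- The list of the terminals. -/
def termList {n : ℕ} (T : Finset (Fin n)) : List ℕ := (T.sort (· ≤ ·)).map Fin.val

theorem mem_termList {n : ℕ} {T : Finset (Fin n)} {v : Fin n} : v ∈ T ↔ (v : ℕ) ∈ termList T := by
  unfold termList
  rw [List.mem_map]
  constructor
  · intro h
    exact ⟨v, by simpa using h, rfl⟩
  · rintro ⟨u, hu, h⟩
    rw [← Fin.ext h]
    simpa using hu

theorem termList_length {n : ℕ} (T : Finset (Fin n)) : (termList T).length ≤ n := by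
  simp only [termList, List.length_map, Finset.length_sort]
  exact (Finset.card_le_univ T).trans_eq (Fintype.card_fin n)

/-- Only unions need the factor `4 ^ W`, from `2 ^ (2 * W + 1)` in `spec_split`; the other
operations are polynomial in `B`. -/
theorem spec_leaf {n w B W : ℕ} {T : Finset (Fin n)} {Φ : WExpr (Fin n) w} (hΦ : Φ.Valid)
    (hW : maxLabel Φ + 3 ≤ W) (hB : 2 * W + n ≤ B) {st : List ℕ} (hs : InRange st (bases W)) :
    Spec 13 (.cons (.cons (.cons (.ofNat W) (encList (termList T))) (node W T Φ)) (encList st))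
      (.ofNat (cost W T Φ st)) (4000 * (B + 1) ^ 3 * 4 ^ W) := by
  have hlen : st.length = 2 * W := by rw [hs.length_eq, bases_length]
  have hsq : B + 1 ≤ (B + 1) ^ 2 := by nlinarith
  have hcu : (B + 1) ^ 2 ≤ (B + 1) ^ 3 := Nat.pow_le_pow_right (by omega) (by omega)
  have hfour : (B + 1) ^ 3 * 1 ≤ (B + 1) ^ 3 * 4 ^ W := Nat.mul_le_mul_left _ (Nat.one_le_pow _ _ (by norm_num))
  have hcost : ∀ Ψ : WExpr (Fin n) w, Ψ.Valid → ∀ s, cost W T Ψ s ≤ B + 1 := fun Ψ h s => by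
    have h1 := cost_le W T Ψ h s
    have h2 : Ψ.verts.card ≤ n := (Finset.card_le_univ _).trans_eq (Fintype.card_fin n)
    omega
  have hd : ∀ d ∈ st, d ≤ B := fun d hd => by
    have := hs.lt (bases_le (by omega)) d hd
    omega
  have hmul : 4000 * (B + 1) ^ 3 * 4 ^ W = 4000 * ((B + 1) ^ 3 * 4 ^ W) := by ring
  rw [hmul]
  cases Φ with
  | intro i v =>
    simp only [maxLabel] at hW
    refine ⟨_, rfl, ?_⟩
    simp [leafBody, node, cost]
    have := termList_length T
    refine (spec_intro (B := B) (i := i) (v := v) (termList T) st (v ∈ T) mem_termList (by omega)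
      (by omega) (by omega) hd).use fun t ht => ⟨rfl, ?_⟩
    omega
  | union a b =>
    simp only [maxLabel] at hW
    refine ⟨_, rfl, ?_⟩
    simp [leafBody, node, cost]
    refine (spec_split (B := B) st (bases W) _ _ _ _ hs
      (fun b hb => by have := bases_le (by omega) b hb; omega) (isTable_table W T a)
      (isTable_table W T b) (hcost a hΦ.1) (hcost b hΦ.2.1)).use fun t ht => ⟨rfl, ?_⟩
    have h1 : 200 * (B + 1) * (2 ^ (st.length + 1) - 1) ≤ 400 * ((B + 1) ^ 3 * 4 ^ W) := by
      calc 200 * (B + 1) * (2 ^ (st.length + 1) - 1) ≤ 200 * (B + 1) ^ 3 * (2 ^ (st.length + 1)) := by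
            gcongr
            · exact hsq.trans hcu
            · exact Nat.sub_le _ _
        _ = 400 * ((B + 1) ^ 3 * 4 ^ W) := by
            rw [hlen, pow_succ 2 (2 * W), pow_mul]; ring
    omega
  | rename i j a =>
    simp only [maxLabel] at hW
    refine ⟨_, rfl, ?_⟩
    simp [leafBody, node, cost]
    refine (spec_rename (B := B) (i := i) (j := j) (isTable_table W T a) hs (by omega) (by omega)
      (by omega)).use fun t ht => ⟨by simp, ?_⟩
    omega
  | join i j a =>
    simp only [maxLabel] at hW
    refine ⟨_, rfl, ?_⟩
    simp [leafBody, node, cost]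
    refine (spec_joinAll (B := B) (i := i) (j := j) (isTable_table W T a) (hcost a hΦ) hs (by omega)
      (by omega) (by omega) (by omega)).use fun t ht => ⟨rfl, ?_⟩
    omega

/-- Time spent for one operation of an expression. -/
def nodeTime (W B : ℕ) : ℕ :=
  buildTime (4000 * (B + 1) ^ 3 * 4 ^ W + 20 * (B + 2)) (bases W) + 60

theorem spec_solve {n w B W : ℕ} {T : Finset (Fin n)} (Φ : WExpr (Fin n) w) (hΦ : Φ.Valid)
    (hW : maxLabel Φ + 3 ≤ W) (hB : 2 * W + n ≤ B) :
    Spec 17 (.cons (.cons (encList (bases W)) (.cons (.ofNat W) (encList (termList T)))) Φ.encode)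
      (table W T Φ) (Φ.size * nodeTime W B) := by
  -- Building the table is the same step for all operations, given the node with the tables of its
  -- operands. Since this fact depends on `Φ`, each induction hypothesis asks for it anew.
  have hbuild : Spec 16 (.cons (.cons (.cons (.ofNat W) (encList (termList T))) (node W T Φ))
      (.cons (encList (bases W)) (.cons .nil .nil))) (table W T Φ)
      (buildTime (4000 * (B + 1) ^ 3 * 4 ^ W + 20 * (B + 2)) (bases W)) :=
    spec_build (B := B) (bases W) [] (by rw [bases_length]; simp; omega)
      fun s hs => spec_leaf hΦ hW hB hs
  induction Φ with
  | intro i v =>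
    refine ⟨_, rfl, ?_⟩
    simp [solveBody, WExpr.encode, WExpr.size]
    refine hbuild.use fun t ht => ⟨rfl, ?_⟩
    unfold nodeTime
    omega
  | union a b iha ihb =>
    simp only [maxLabel] at hW
    replace iha := iha hΦ.1 (by omega) (spec_build (B := B) (bases W) []
      (by rw [bases_length]; simp; omega) fun s hs => spec_leaf hΦ.1 (by omega) hB hs)
    replace ihb := ihb hΦ.2.1 (by omega) (spec_build (B := B) (bases W) []
      (by rw [bases_length]; simp; omega) fun s hs => spec_leaf hΦ.2.1 (by omega) hB hs)
    refine ⟨_, rfl, ?_⟩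
    simp [solveBody, WExpr.encode, WExpr.size]
    refine iha.use fun t1 ht1 => ihb.use fun t2 ht2 => hbuild.use fun t ht => ⟨rfl, ?_⟩
    rw [add_mul, add_mul]
    generalize a.size * nodeTime W B = x at *
    generalize b.size * nodeTime W B = y at *
    unfold nodeTime
    omega
  | rename i j a ih | join i j a ih =>
    simp only [maxLabel] at hW
    replace ih := ih hΦ (by omega) (spec_build (B := B) (bases W) []
      (by rw [bases_length]; simp; omega) fun s hs => spec_leaf (Φ := a) hΦ (by omega) hB hs)
    refine ⟨_, rfl, ?_⟩
    simp [solveBody, WExpr.encode, WExpr.size]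
    refine ih.use fun t1 ht1 => hbuild.use fun t ht => ⟨rfl, ?_⟩
    rw [add_mul]
    generalize a.size * nodeTime W B = x at *
    unfold nodeTime
    omega

/-! ### The main theorem -/

theorem encodeInstance_eq {n w : ℕ} (Ψ : WExpr (Fin n) w) (T : Finset (Fin n)) (k : ℕ) :
    encodeInstance Ψ T k = .cons Ψ.encode (.cons (encList (termList T)) (.ofNat k)) := by
  simp only [encodeInstance, encList, termList, List.map_map]
  simp [← List.map_eq_flatMap, Function.comp_def]

theorem inRange_replicate (W : ℕ) (hW : 1 ≤ W) :
    InRange (List.replicate (2 * W) 0) (bases W) := by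
  unfold InRange
  rw [List.forall₂_iff_get]
  refine ⟨by simp [bases_length], fun i h1 h2 => ?_⟩
  have := @bases_get W i _ (List.getElem?_eq_getElem h2)
  simp only [List.get_eq_getElem, List.getElem_replicate]
  by_cases h : i < W <;> omega

theorem wp_main {n w k : ℕ} {G : SimpleGraph (Fin n)} {T : Finset (Fin n)} {Ψ : WExpr (Fin n) w}
    (hΨ : Ψ.IsExpressionOf G) {W B : ℕ} (hW : W = maxLabel Ψ + 3) (hB : B = 2 * W + n) :
    WP [encodeInstance Ψ T k] mainBody fun v t =>
      (∃ answer : Bool, v = .ofBool answer ∧ (answer = true ↔ NodeMultiwayCut G T k)) ∧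
      t ≤ Ψ.size * (40 * (w + 2)) + Ψ.size * nodeTime W B + 400 * (B + 1) ^ 2 := by
  have hsq : B + 1 ≤ (B + 1) ^ 2 := by nlinarith
  have hcost := cost_le W T Ψ hΨ.1 (List.replicate (2 * W) 0)
  have hn : Ψ.verts.card ≤ n := (Finset.card_le_univ _).trans_eq (Fintype.card_fin n)
  have hcorrect := cost_le_iff (k := k) (T := T) hΨ hW.ge
  rw [encodeInstance_eq]
  simp [mainBody]
  refine (spec_maxLabel Ψ).use fun t1 ht1 => ?_
  have eW : Val.cons .nil (.cons .nil (.cons .nil (.ofNat (maxLabel Ψ)))) = .ofNat W := by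
    rw [hW]; rfl
  simp only [eW]
  refine (spec_plus W W).use fun t2 ht2 => ?_
  have h1 := spec_rep W 2 []
  have h2 := spec_rep W (2 * W) (List.replicate W 2)
  have h3 := spec_rep (2 * W) 0 []
  simp only [List.append_nil, encList_nil] at h1 h3
  refine h1.use fun t3 ht3 => ?_
  rw [← two_mul]
  refine h2.use fun t4 ht4 => ?_
  refine (spec_solve (T := T) Ψ hΨ.1 hW.ge hB.ge).use fun t5 ht5 => ?_
  refine h3.use fun t6 ht6 => ?_
  refine (spec_lookup_table (B := B) (isTable_table W T Ψ) (inRange_replicate W (by omega))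
    (by omega) (by omega)).use fun t7 ht7 => ?_
  generalize cost W T Ψ (List.replicate (2 * W) 0) = c at *
  by_cases hc : c = 0
  · simp [hc]
    exact ⟨Or.inl ⟨rfl, by rw [← hcorrect]; simp [hc]⟩, by omega⟩
  · simp [hc]
    -- Costs are shifted by one, so the budget is compared as `k + 1`.
    refine (spec_le c (k + 1)).use fun t8 ht8 => ⟨?_, by omega⟩
    by_cases hk : c ≤ k + 1
    · exact Or.inr ⟨by simp [hk], hcorrect.1 ⟨hc, hk⟩⟩
    · exact Or.inl ⟨by simp [hk], fun h => hk (hcorrect.2 h).2⟩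

-- Arithmetic of the time bound

/-- For `w + 3 ≥ A` no constant is needed; the remaining `w` are below `A`, so `A ^ A` bounds them
all. -/
theorem exists_pow_le (A : ℕ) : ∃ C, ∀ w, A ^ w ≤ C * (w + 3) ^ w := by
  refine ⟨A ^ A + 1, fun w => ?_⟩
  by_cases h : A ≤ w + 3
  · calc A ^ w ≤ (w + 3) ^ w := Nat.pow_le_pow_left h w
      _ ≤ _ := Nat.le_mul_of_pos_left _ (by omega)
  · have h1 : A ^ w ≤ A ^ A := Nat.pow_le_pow_right (by omega) (by omega)
    have h2 : 1 ≤ (w + 3) ^ w := Nat.one_le_pow _ _ (by omega)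
    calc A ^ w ≤ (A ^ A + 1) * 1 := by omega
      _ ≤ _ := Nat.mul_le_mul_left _ h2

theorem verts_nonempty {n w : ℕ} (Φ : WExpr (Fin n) w) : Φ.verts.Nonempty := by
  induction Φ with
  | intro i v => exact Finset.singleton_nonempty v
  | union a b iha _ => exact iha.mono Finset.subset_union_left
  | rename i j a ih | join i j a ih => exact ih

theorem time_le : ∃ C, ∀ s w n W B : ℕ, 1 ≤ s → 1 ≤ n → W ≤ w + 2 → B = 2 * W + n →
    s * (40 * (w + 2)) + s * nodeTime W B + 400 * (B + 1) ^ 2 ≤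
      C * s * (w + 3) ^ (2 * w) * n ^ 3 := by
  obtain ⟨C, hC⟩ := exists_pow_le 1024
  -- The factors come from `h5`, from `2 ^ 3` in `hBn` cubed, from `32 ^ 2`, from `3 ^ 5` in `h3`,
  -- and from `exists_pow_le`.
  refine ⟨10000 * 8 * 1024 * 243 * C, fun s w n W B hs hn hW hB => ?_⟩
  have hsq : B + 1 ≤ (B + 1) ^ 2 := by nlinarith
  have hcu : (B + 1) ^ 2 ≤ (B + 1) ^ 3 := Nat.pow_le_pow_right (by omega) (by omega)
  have hfour : (B + 1) ^ 3 * 1 ≤ (B + 1) ^ 3 * 4 ^ W :=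
    Nat.mul_le_mul_left _ (Nat.one_le_pow _ _ (by norm_num))
  have hBn : B + 1 ≤ 2 * (w + 3) * n := by nlinarith
  have h1 : nodeTime W B ≤ 5000 * (B + 1) ^ 3 * (32 * (w + 3)) ^ (w + 2) := by
    refine (buildTime_bases_le _ _).trans ?_
    calc (4000 * (B + 1) ^ 3 * 4 ^ W + 20 * (B + 2) + 60) * (8 * (W + 1)) ^ W
        ≤ (5000 * ((B + 1) ^ 3 * 4 ^ W)) * (8 * (W + 1)) ^ W := by
          gcongr
          rw [mul_assoc]
          omega
      _ = 5000 * (B + 1) ^ 3 * (32 * (W + 1)) ^ W := by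
          rw [show 32 * (W + 1) = 4 * (8 * (W + 1)) by ring, mul_pow 4]; ring
      _ ≤ 5000 * (B + 1) ^ 3 * (32 * (w + 3)) ^ W :=
          Nat.mul_le_mul_left _ (Nat.pow_le_pow_left (by omega) _)
      _ ≤ _ := Nat.mul_le_mul_left _ (Nat.pow_le_pow_right (by omega) hW)
  have h2 : w + 3 ≤ (32 * (w + 3)) ^ (w + 2) :=
    (by omega : w + 3 ≤ 32 * (w + 3)).trans (Nat.le_self_pow (by omega) _)
  -- The surplus power has exponent `3 + 2`: three from the cube of `B + 1`, two from the exponent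
  -- `w + 2`. It is traded for another `32 ^ w`, so that `1024 ^ w` remains.
  have h3 : (w + 3) ^ 5 ≤ 243 * 32 ^ w := by
    have : w + 3 ≤ 3 * 2 ^ w := by
      have := Nat.lt_two_pow_self (n := w)
      omega
    calc (w + 3) ^ 5 ≤ (3 * 2 ^ w) ^ 5 := Nat.pow_le_pow_left this 5
      _ = 243 * 32 ^ w := by rw [mul_pow, ← pow_mul, mul_comm w, pow_mul]; norm_num
  have h4 : 1 ≤ (B + 1) ^ 3 := Nat.one_le_pow _ _ (by omega)
  have h5 : 40 * (w + 2) + nodeTime W B + 400 * (B + 1) ^ 2 ≤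
      10000 * (B + 1) ^ 3 * (32 * (w + 3)) ^ (w + 2) := by
    generalize (32 * (w + 3)) ^ (w + 2) = e at *
    generalize (B + 1) ^ 3 = b at *
    have e1 : 1 * e ≤ b * e := Nat.mul_le_mul_right _ h4
    have e2 : b * 1 ≤ b * e := Nat.mul_le_mul_left _ (by omega)
    rw [mul_assoc] at h1 ⊢
    omega
  have h6 : 400 * (B + 1) ^ 2 ≤ s * (400 * (B + 1) ^ 2) := Nat.le_mul_of_pos_left _ hs
  calc s * (40 * (w + 2)) + s * nodeTime W B + 400 * (B + 1) ^ 2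
      ≤ s * (40 * (w + 2) + nodeTime W B + 400 * (B + 1) ^ 2) := by
        rw [mul_add s, mul_add s]; exact Nat.add_le_add_left h6 _
    _ ≤ s * (10000 * (2 * (w + 3) * n) ^ 3 * (32 * (w + 3)) ^ (w + 2)) := by
        refine Nat.mul_le_mul_left _ (h5.trans ?_)
        gcongr
    _ = 10000 * 8 * 1024 * s * (w + 3) ^ w * n ^ 3 * 32 ^ w * (w + 3) ^ 5 := by
        rw [mul_pow 32]; ring
    _ ≤ 10000 * 8 * 1024 * s * (w + 3) ^ w * n ^ 3 * 32 ^ w * (243 * 32 ^ w) :=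
        Nat.mul_le_mul_left _ h3
    _ = 10000 * 8 * 1024 * 243 * s * (w + 3) ^ w * n ^ 3 * 1024 ^ w := by
        rw [show 1024 = 32 * 32 by norm_num, mul_pow 32 32 w]; ring
    _ ≤ 10000 * 8 * 1024 * 243 * s * (w + 3) ^ w * n ^ 3 * (C * (w + 3) ^ w) :=
        Nat.mul_le_mul_left _ (hC w)
    _ = _ := by rw [two_mul, pow_add]; ring

end MultiwayCut

theorem mainTheorem10 :
    ∃ (P : Program) (c : ℕ), ∀ (w n : ℕ) (G : SimpleGraph (Fin n)) (T : Finset (Fin n)) (k : ℕ)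
      (Ψ : WExpr (Fin n) w), Ψ.IsExpressionOf G →
        ∃ (answer : Bool) (t : ℕ),
          P.Runs (encodeInstance Ψ T k) (Val.ofBool answer) t ∧
          (answer = true ↔ NodeMultiwayCut G T k) ∧
          t ≤ c * Ψ.size * (w + 3) ^ (2 * w) * n ^ c := by
  obtain ⟨C, hC⟩ := MultiwayCut.time_le
  -- One constant is both factor and exponent, so it has to dominate `C` and `3`; raising the
  -- exponent of `n` uses `1 ≤ n`, which holds because an expression has a vertex.
  refine ⟨MultiwayCut.prog, C + 3, fun w n G T k Ψ hΨ => ?_⟩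
  obtain ⟨_, t, he, ⟨answer, rfl, ha⟩, ht⟩ := MultiwayCut.wp_main (k := k) (T := T) hΨ rfl rfl
  refine ⟨answer, t, he, ha, ht.trans ?_⟩
  have hn : 1 ≤ n := by
    obtain ⟨v, _⟩ := MultiwayCut.verts_nonempty Ψ
    have := v.2
    omega
  have hs : 1 ≤ Ψ.size := by cases Ψ <;> simp [WExpr.size]
  have := MultiwayCut.maxLabel_lt Ψ
  refine (hC _ w n _ _ hs hn (by omega) rfl).trans ?_
  gcongr <;> omega
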